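/- **Conventions.** A surface $M^2: z=z(u,v)$, $(u,v)\in\mathcal D_0$, in $\mathbb E^4$ is a smooth immersion $z:\mathcal D_0\to\mathbb E^4$ of a domain (non-empty connected open set) $\mathcal D_0\subset\mathbb R^2$; $E,F,G$ are the coefficients of its first fundamental form, $\nabla'$ is the flat connection of $\mathbb E^4$, $\sigma$ the second fundamental form and $H=\frac12\operatorname{tr}\sigma$ the mean curvature vector field. $M^2$ has *parallel normalized mean curvature vector field* if $H$ vanishes nowhere and the unit vector field $H/\|H\|$ is parallel in the normal bundle. A *geometric frame field* of $M^2$, parametrized by its principal lines, is an orthonormal frame field $\{x,y,b,l\}$ along $M^2$ with $x=z_u/\sqrt E$, $y=z_v/\sqrt G$ principal directions (i.e. $x\perp y$ and $\sigma(x,x),\sigma(y,y)$ linearly dependent) and $b,l$ smooth unit normal fields, $b$ collinear with $H$. The functions $\lambda,\mu,\nu$ are *the geometric functions* of $M^2$ (with respect to this frame field) if $$\langle\nabla'_xx,b\rangle=\langle\nabla'_yy,b\rangle=\nu,\qquad \langle\nabla'_xy,b\rangle=\lambda,\qquad \langle\nabla'_xy,l\rangle=\mu .$$ The parameters $(u,v)$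 are *canonical* if $E=G=\frac1{|\mu|}$ and $F=0$. **Theorem** (fundamental existence and uniqueness theorem in $\mathbb E^4$). Let $\lambda,\mu,\nu$ be smooth real functions on a domain $\mathcal D\subset\mathbb R^2$ such that $\mu\neq0$ everywhere, $\nu$ is not constant, and $$\nu_u=\lambda_v-\lambda(\ln|\mu|)_v,\qquad \nu_v=\lambda_u-\lambda(\ln|\mu|)_u,\qquad \nu^2-(\lambda^2+\mu^2)=\tfrac12|\mu|\,\Delta\ln|\mu|,\qquad \Delta=\tfrac{\partial^2}{\partial u^2}+\tfrac{\partial^2}{\partial v^2}.$$ Then there are points $q\in\mathcal D$ with $\nu(q)\neq0$; and for every such point $q_0\in\mathcal D$ ($\nu(q_0)\ne0$), every $p_0\in\mathbb E^4$ and every orthonormal frame $\{x_0,y_0,b_0,l_0\}$ at $p_0$ there exist a subdomain $\mathcal D_0\subset\mathcal D$ containing $q_0$ and a unique surface $M^2: z=z(u,v)$, $(u,v)\in\mathcal D_0$, with parallel normalized mean curvature vector field and canonical parameters $(u,v)$, such that $z(q_0)=p_0$ and $M^2$ has a geometric frame field which equals $\{x_0,y_0,b_0,l_0\}$ at $q_0$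 and with respect to which $\lambda,\mu,\nu$ (restricted to $\mathcal D_0$) are the geometric functions of $M^2$. -/

import Mathlib

open scoped ContDiff

noncomputable section

/-- Euclidean 4-space. -/
abbrev E4 : Type := EuclideanSpace ℝ (Fin 4)

namespace PNMC

section Plane

variable {V : Type*} [NormedAddCommGroup V] [NormedSpace ℝ V]

/-- The partial derivative `f_u` of a function of two real variables `(u, v)`. -/
def pu (f : ℝ × ℝ → V) (p : ℝ × ℝ) : V := fderiv ℝ f p (1, 0)

/-- The partial derivative `f_v` of a function of two real variables `(u, v)`. -/
def pv (f : ℝ × ℝ → V) (p : ℝ × ℝ) : V := fderiv ℝ f p (0, 1)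

/-- The Laplace operator `∂²/∂u² + ∂²/∂v²`. -/
def laplace (f : ℝ × ℝ → V) (p : ℝ × ℝ) : V := pu (pu f) p + pv (pv f) p

end Plane

/-- `z : D → E⁴` is a smooth regular (immersed) parametrized surface `z = z(u,v)`. -/
structure IsSurface (D : Set (ℝ × ℝ)) (z : ℝ × ℝ → E4) : Prop where
  smooth : ContDiffOn ℝ ∞ z D
  regular : ∀ p ∈ D, LinearIndependent ℝ ![pu z p, pv z p]

/-- Coefficients of the first fundamental form. -/
def coeffE (z : ℝ × ℝ → E4) (p : ℝ × ℝ) : ℝ := inner ℝ (pu z p) (pu z p)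

def coeffF (z : ℝ × ℝ → E4) (p : ℝ × ℝ) : ℝ := inner ℝ (pu z p) (pv z p)

def coeffG (z : ℝ × ℝ → E4) (p : ℝ × ℝ) : ℝ := inner ℝ (pv z p) (pv z p)

/-- The tangent plane of the surface at the parameter value `p`. -/
def tangentPlane (z : ℝ × ℝ → E4) (p : ℝ × ℝ) : Submodule ℝ E4 :=
  Submodule.span ℝ {pu z p, pv z p}

/-- The orthogonal projection of a vector of `E⁴` to the normal plane at `p`. -/
def normalPart (z : ℝ × ℝ → E4) (p : ℝ × ℝ) (w : E4) : E4 :=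
  (tangentPlane z p)ᗮ.starProjection w

/-- The flat connection `∇'` of `E⁴` along the surface: the derivative at `p` of a vector field
`ξ` along the surface, in the direction of the tangent vector `dz(X)`. -/
def flatDeriv (ξ : ℝ × ℝ → E4) (p : ℝ × ℝ) (X : ℝ × ℝ) : E4 := fderiv ℝ ξ p X

/-- The second fundamental form `σ(dz(X), dz(Y))`, for coordinate vectors `X` and `Y`: by the
formula of Gauss, the normal component of `∇'_{dz(X)} dz(Y)`. -/
def secondForm (z : ℝ × ℝ → E4) (p : ℝ × ℝ) (X Y : ℝ × ℝ) : E4 :=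
  normalPart z p (flatDeriv (fun q => fderiv ℝ z q Y) p X)

/-- The mean curvature vector `H = (1/2) tr σ`, the trace being taken with respect to the first
fundamental form. -/
def meanCurvature (z : ℝ × ℝ → E4) (p : ℝ × ℝ) : E4 :=
  (2 * (coeffE z p * coeffG z p - coeffF z p ^ 2))⁻¹ •
    (coeffG z p • secondForm z p (1, 0) (1, 0)
      - (2 * coeffF z p) • secondForm z p (1, 0) (0, 1)
      + coeffE z p • secondForm z p (0, 1) (0, 1))

/-- The normal connection `D_{dz(X)} ξ`, by the formula of Weingarten the normal component of
`∇'_{dz(X)} ξ`. -/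
def normalDeriv (z ξ : ℝ × ℝ → E4) (p : ℝ × ℝ) (X : ℝ × ℝ) : E4 :=
  normalPart z p (flatDeriv ξ p X)

/-- The surface has parallel normalized mean curvature vector field: `H` vanishes nowhere and the
unit normal field in the direction of `H` is parallel in the normal bundle. -/
structure HasParallelNormalizedMeanCurvature (D : Set (ℝ × ℝ)) (z : ℝ × ℝ → E4) : Prop where
  ne_zero : ∀ p ∈ D, meanCurvature z p ≠ 0
  parallel : ∀ p ∈ D, ∀ X : ℝ × ℝ,
    normalDeriv z (fun q => ‖meanCurvature z q‖⁻¹ • meanCurvature z q) p X = 0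

/-- The coordinate vector of the unit tangent vector `z_u / √E`. -/
def unitU (z : ℝ × ℝ → E4) (p : ℝ × ℝ) : ℝ × ℝ := ((√(coeffE z p))⁻¹, 0)

/-- The coordinate vector of the unit tangent vector `z_v / √G`. -/
def unitV (z : ℝ × ℝ → E4) (p : ℝ × ℝ) : ℝ × ℝ := (0, (√(coeffG z p))⁻¹)

/-- `{x, y, b, l}` is the geometric frame field of the surface, which is parametrized by its
principal lines: an orthonormal frame field in which `x = z_u / √E` and `y = z_v / √G` are
principal directions (orthogonal tangent directions with `σ(x,x)` and `σ(y,y)` linearly dependent,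
that is, `x` and `y` are orthogonal and conjugate) and the unit normal field `b` is collinear with
the mean curvature vector field. -/
structure IsGeometricFrame (D : Set (ℝ × ℝ)) (z x y b l : ℝ × ℝ → E4) : Prop where
  smooth_b : ContDiffOn ℝ ∞ b D
  smooth_l : ContDiffOn ℝ ∞ l D
  orthonormal : ∀ p ∈ D, Orthonormal ℝ ![x p, y p, b p, l p]
  x_eq : ∀ p ∈ D, x p = fderiv ℝ z p (unitU z p)
  y_eq : ∀ p ∈ D, y p = fderiv ℝ z p (unitV z p)
  principal : ∀ p ∈ D, ¬ LinearIndependent ℝ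
    ![secondForm z p (unitU z p) (unitU z p), secondForm z p (unitV z p) (unitV z p)]
  collinear : ∀ p ∈ D, ∃ c : ℝ, meanCurvature z p = c • b p

/-- `lam`, `mu`, `nu` are the geometric functions of the surface with respect to the frame field
`{x, y, b, l}`: `ν₁ = ⟨∇'_x x, b⟩` and `ν₂ = ⟨∇'_y y, b⟩` are both equal to `nu`, and
`lam = ⟨∇'_x y, b⟩`, `mu = ⟨∇'_x y, l⟩`. -/
structure HasGeometricFunctions (D : Set (ℝ × ℝ)) (z x y b l : ℝ × ℝ → E4)
    (lam mu nu : ℝ × ℝ → ℝ) : Prop where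
  nu_one : ∀ p ∈ D, inner ℝ (flatDeriv x p (unitU z p)) (b p) = nu p
  nu_two : ∀ p ∈ D, inner ℝ (flatDeriv y p (unitV z p)) (b p) = nu p
  lam_eq : ∀ p ∈ D, inner ℝ (flatDeriv y p (unitU z p)) (b p) = lam p
  mu_eq : ∀ p ∈ D, inner ℝ (flatDeriv y p (unitU z p)) (l p) = mu p

/-- The parameters `(u, v)` are canonical: `E = G = 1 / |μ|` and `F = 0`. -/
structure IsCanonical (D : Set (ℝ × ℝ)) (z : ℝ × ℝ → E4) (mu : ℝ × ℝ → ℝ) : Prop where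
  E_eq : ∀ p ∈ D, coeffE z p = 1 / |mu p|
  F_eq : ∀ p ∈ D, coeffF z p = 0
  G_eq : ∀ p ∈ D, coeffG z p = 1 / |mu p|

/-- `z = z(u,v)`, `(u,v) ∈ D`, is a surface with parallel normalized mean curvature vector field
that passes through `p₀ = z(q₀)`, has `{x₀, y₀, b₀, l₀}` as its geometric frame at that point and
`lam`, `mu`, `nu` as its geometric functions, and for which `(u,v)` are canonical parameters. -/
def IsRealization (D : Set (ℝ × ℝ)) (lam mu nu : ℝ × ℝ → ℝ) (q₀ : ℝ × ℝ)
    (p₀ x₀ y₀ b₀ l₀ : E4) (z : ℝ × ℝ → E4) : Prop :=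
  IsSurface D z ∧ HasParallelNormalizedMeanCurvature D z ∧ z q₀ = p₀ ∧
    (∃ x y b l : ℝ × ℝ → E4, IsGeometricFrame D z x y b l ∧
      x q₀ = x₀ ∧ y q₀ = y₀ ∧ b q₀ = b₀ ∧ l q₀ = l₀ ∧
      HasGeometricFunctions D z x y b l lam mu nu) ∧
    IsCanonical D z mu

end PNMC

end

/-! The theorem is a Frobenius theorem for a moving frame. Put `φ = |μ|^(-1/2)` and `g = ln|μ|`. For
a surface of the required kind the derivatives of `(z, x, y, b, l)` are forced: `z_u = φx`, `z_v =
φy`, and the frame satisfies a linear system whose coefficients are `g_u/2`, `g_v/2`, `φν`, `φλ`,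
`φμ` up to sign. This is `CanonicalEquations`.

Existence. The compatibility conditions of this system are exactly the closing of `dz` together with
the equations of Gauss and Codazzi (Ricci holds identically), and they reduce to the three given
equations. `exists_solution_of_compatible` then solves the system near `q₀`. The frame matrix is
skew-symmetric, so a frame orthonormal at `q₀` remains orthonormal
(`StructureEquations.orthonormal`), and `CanonicalEquations.isRealization` reads the geometry off
the equations. Its mean curvature vector is `νb`, which is why one works where `ν ≠ 0`.

Uniqueness. `exists_canonicalEquations_of_isRealization` shows that any realization, with whatever
geometric frame it comes with, satisfies the same system. Two solutions agreeing at `q₀` coincide by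
`StructureEquations.eqOn`, which uses the quantity conserved by skew-symmetry once more. -/

noncomputable section

namespace PNMC

/-! ### Linear total differential systems `W_u = AW`, `W_v = BW` in a Banach space. -/

section LinearSystem

open Set Metric

variable {V : Type*} [NormedAddCommGroup V] [NormedSpace ℝ V]

/-- Grönwall's inequality to the right of the initial time, with a bound linear in the data. -/
lemma norm_le_mul_exp_right {f f' : ℝ → V} {a b M δ e : ℝ} (hM : 1 ≤ M) (he : 0 ≤ e)
    (hf : ∀ t ∈ Icc a b, HasDerivWithinAt f (f' t) (Icc a b) t) (ha : ‖f a‖ ≤ δ)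
    (hb : ∀ t ∈ Icc a b, ‖f' t‖ ≤ M * ‖f t‖ + e) :
    ∀ t ∈ Icc a b, ‖f t‖ ≤ (δ + e) * Real.exp (M * (b - a)) := by
  intro t ht
  have hδ : 0 ≤ δ := (norm_nonneg _).trans ha
  have key := norm_le_gronwallBound_of_norm_deriv_right_le (f := f) (f' := f') (δ := δ) (K := M)
    (ε := e) (a := a) (b := b) (fun s hs => (hf s hs).continuousWithinAt)
    (fun s hs => (hf s (Ico_subset_Icc_self hs)).mono_of_mem_nhdsWithin
      (Icc_mem_nhdsGE_of_mem hs)) ha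
    (fun s hs => hb s (Ico_subset_Icc_self hs)) t ht
  -- The bound is `δ exp(M(t-a)) + (e/M)(exp(M(t-a)) - 1)`; since `1 ≤ M`, the division can be
  -- dropped.
  rw [gronwallBound_of_K_ne_0 (by positivity)] at key
  refine key.trans ?_
  have h1 : Real.exp (M * (t - a)) ≤ Real.exp (M * (b - a)) := by
    have := ht.2
    gcongr
  have h2 : e / M ≤ e := div_le_self he hM
  have h3 : 1 ≤ Real.exp (M * (t - a)) := by
    apply Real.one_le_exp
    have := ht.1
    exact mul_nonneg (by linarith) (by linarith)
  have h4 : e / M * (Real.exp (M * (t - a)) - 1) ≤ e * Real.exp (M * (b - a)) :=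
    mul_le_mul h2 (by linarith) (by linarith) he
  have h5 : δ * Real.exp (M * (t - a)) ≤ δ * Real.exp (M * (b - a)) := by gcongr
  simp only
  nlinarith

/-- Grönwall's inequality on both sides of the initial time. -/
lemma norm_le_mul_exp {f f' : ℝ → V} {c ε M δ e : ℝ} (hM : 1 ≤ M) (hε : 0 ≤ ε) (he : 0 ≤ e)
    (hf : ∀ t ∈ Icc (c - ε) (c + ε), HasDerivWithinAt f (f' t) (Icc (c - ε) (c + ε)) t)
    (hc : ‖f c‖ ≤ δ) (hb : ∀ t ∈ Icc (c - ε) (c + ε), ‖f' t‖ ≤ M * ‖f t‖ + e) :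
    ∀ t ∈ Icc (c - ε) (c + ε), ‖f t‖ ≤ (δ + e) * Real.exp (M * ε) := by
  intro t ht
  rcases le_total c t with h | h
  · have hsub : Icc c (c + ε) ⊆ Icc (c - ε) (c + ε) := Icc_subset_Icc (by linarith) le_rfl
    simpa using norm_le_mul_exp_right hM he (fun s hs => (hf s (hsub hs)).mono hsub) hc
      (fun s hs => hb s (hsub hs)) t ⟨h, ht.2⟩
  · have hmaps : MapsTo (fun s : ℝ => -s) (Icc (-c) (-c + ε)) (Icc (c - ε) (c + ε)) := by
      intro s hs
      constructor <;> simp only <;> linarith [hs.1, hs.2]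
    have := norm_le_mul_exp_right (f := fun s => f (-s)) (f' := fun s => -f' (-s)) (a := -c)
      (b := -c + ε) (δ := δ) hM he
      (fun s hs => by
        have := (hf (-s) (hmaps hs)).scomp s (hasDerivWithinAt_id s _).neg hmaps
        simpa [Function.comp_def] using this)
      (by simpa using hc) (fun s hs => by simpa using hb (-s) (hmaps hs)) (-t)
      ⟨by linarith, by linarith [ht.1]⟩
    simpa using this

/-- A linear differential equation whose coefficient is bounded by `M` has a solution on every
interval of radius at most `1 / (2 M)`. -/
lemma exists_solution_linear [CompleteSpace V] {B : ℝ → V →L[ℝ] V} {c ε M : ℝ} (hM : 0 ≤ M)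
    (hε : 0 ≤ ε) (hMε : M * ε ≤ 1 / 2) (hB : ContinuousOn B (Icc (c - ε) (c + ε)))
    (hbd : ∀ t ∈ Icc (c - ε) (c + ε), ‖B t‖ ≤ M) (w : V) :
    ∃ α : ℝ → V, α c = w ∧ ∀ t ∈ Icc (c - ε) (c + ε),
      HasDerivWithinAt α (B t (α t)) (Icc (c - ε) (c + ε)) t := by
  have hw := norm_nonneg w
  -- Picard–Lindelöf on the ball of radius `‖w‖` about `w`: there `‖x‖ ≤ 2‖w‖`, so the speed is at
  -- most `2M‖w‖`, and a solution stays in the ball for time `ε` because `Mε ≤ 1/2`.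
  refine IsPicardLindelof.exists_eq_forall_mem_Icc_hasDerivWithinAt₀
    (t₀ := ⟨c, by constructor <;> linarith⟩) (a := ⟨‖w‖, hw⟩)
    (L := ⟨M * (2 * ‖w‖), by positivity⟩) (K := ⟨M, hM⟩) ⟨?_, ?_, ?_, ?_⟩
  · intro t ht
    refine (LipschitzWith.weaken (B t).lipschitz ?_).lipschitzOnWith
    exact_mod_cast hbd t ht
  · intro x _
    exact hB.clm_apply continuousOn_const
  · intro t ht x hx
    have hx' : ‖x‖ ≤ 2 * ‖w‖ := by
      have := norm_le_norm_add_norm_sub' x w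
      have h2 : ‖x - w‖ ≤ ‖w‖ := mem_closedBall_iff_norm.mp hx
      linarith
    calc ‖B t x‖ ≤ ‖B t‖ * ‖x‖ := (B t).le_opNorm x
      _ ≤ M * (2 * ‖w‖) := by gcongr; exact hbd t ht
  · simp only [add_sub_cancel_left, sub_sub_cancel, max_self, NNReal.coe_zero, sub_zero]
    change M * (2 * ‖w‖) * ε ≤ ‖w‖
    nlinarith

/-- A `C¹` function is bounded and Lipschitz near a point. -/
lemma exists_bounds_of_contDiffAt {f : ℝ × ℝ → V} {q : ℝ × ℝ} (hf : ContDiffAt ℝ 1 f q) :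
    ∃ M : ℝ, ∃ r > 0, ∀ p ∈ closedBall q r, ‖f p‖ ≤ M ∧
      ∀ p' ∈ closedBall q r, ‖f p' - f p‖ ≤ M * ‖p' - p‖ := by
  obtain ⟨K, s, hs, hl⟩ := hf.exists_lipschitzOnWith
  have hb : ∀ᶠ p in nhds q, ‖f p‖ < ‖f q‖ + 1 :=
    hf.continuousAt.norm.eventually (gt_mem_nhds (lt_add_one _))
  obtain ⟨r, hr, hrs⟩ := nhds_basis_closedBall.mem_iff.mp (Filter.inter_mem hs hb)
  refine ⟨max (‖f q‖ + 1) K, r, hr, fun p hp => ⟨(hrs hp).2.le.trans (le_max_left _ _), ?_⟩⟩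
  intro p' hp'
  refine (hl.norm_sub_le (hrs hp').1 (hrs hp).1).trans ?_
  gcongr
  exact le_max_right _ _

lemma mem_closedBall_prod_iff {q p : ℝ × ℝ} {ε : ℝ} : p ∈ closedBall q ε ↔
    p.1 ∈ Icc (q.1 - ε) (q.1 + ε) ∧ p.2 ∈ Icc (q.2 - ε) (q.2 + ε) := by
  rw [← Real.closedBall_eq_Icc, ← Real.closedBall_eq_Icc, ← closedBall_prod_same, mem_prod]

/-- Second order Taylor bound in the first variable. -/
lemma norm_sub_sub_smul_pu_le {B : ℝ × ℝ → V} {q : ℝ × ℝ} {ε M : ℝ}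
    (hd : ∀ p ∈ closedBall q ε, DifferentiableAt ℝ B p) (hM : 0 ≤ M)
    (hL : ∀ p ∈ closedBall q ε, ∀ p' ∈ closedBall q ε,
      ‖fderiv ℝ B p' - fderiv ℝ B p‖ ≤ M * ‖p' - p‖)
    {u v h : ℝ} (hp : (u, v) ∈ closedBall q ε) (hp' : (u + h, v) ∈ closedBall q ε) :
    ‖B (u + h, v) - B (u, v) - h • pu B (u, v)‖ ≤ M * |h| * |h| := by
  have hsub : segment ℝ (u, v) (u + h, v) ⊆ closedBall q ε :=
    (convex_closedBall q ε).segment_subset hp hp'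
  have hdiff : (u + h, v) - (u, v) = (h, (0 : ℝ)) := by simp
  have hnorm : ‖(h, (0 : ℝ))‖ = |h| := by simp [Prod.norm_def]
  -- Mean value inequality for `B` minus its linearization at `(u, v)`: along the segment the
  -- derivative deviates by at most `M|h|`.
  have := Convex.norm_image_sub_le_of_norm_hasFDerivWithin_le' (𝕜 := ℝ) (f := B) (C := M * |h|)
    (s := segment ℝ (u, v) (u + h, v)) (x := (u, v)) (y := (u + h, v)) (f' := fderiv ℝ B)
    (φ := fderiv ℝ B (u, v)) (fun x hx => (hd x (hsub hx)).hasFDerivAt.hasFDerivWithinAt)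
    (fun x hx => (hL _ hp x (hsub hx)).trans (by
      gcongr
      rw [← hnorm, ← hdiff]
      exact norm_sub_le_of_mem_segment hx)) (convex_segment _ _) (left_mem_segment _ _ _)
    (right_mem_segment _ _ _)
  rw [hdiff, hnorm] at this
  have he : fderiv ℝ B (u, v) (h, 0) = h • pu B (u, v) := by
    rw [pu, ← map_smul]
    simp
  rwa [he] at this

/-- A solution of a total differential system with smooth coefficients is smooth. -/
lemma contDiffOn_of_hasFDerivAt_coprod {A B : ℝ × ℝ → V →L[ℝ] V} {W : ℝ × ℝ → V}
    {s : Set (ℝ × ℝ)} (hs : IsOpen s) (hA : ContDiffOn ℝ ∞ A s) (hB : ContDiffOn ℝ ∞ B s)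
    (hW : ∀ p ∈ s, HasFDerivAt W
      ((ContinuousLinearMap.toSpanSingleton ℝ (A p (W p))).coprod
        (ContinuousLinearMap.toSpanSingleton ℝ (B p (W p)))) p) :
    ContDiffOn ℝ ∞ W s := by
  have hd : DifferentiableOn ℝ W s := fun p hp => (hW p hp).differentiableAt.differentiableWithinAt
  rw [contDiffOn_infty]
  intro n
  -- Bootstrapping: if `W` is `C^n`, the system expresses its derivative through `C^n` functions, so
  -- `W` is `C^(n+1)`.
  induction n with
  | zero => exact contDiffOn_zero.mpr hd.continuousOn
  | succ n ih =>
    have hn : ((n : ℕ) : WithTop ℕ∞) ≤ ∞ := by exact_mod_cast le_top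
    push_cast
    rw [contDiffOn_succ_iff_fderiv_of_isOpen hs]
    refine ⟨hd, by simp, ?_⟩
    have h1 : ContDiffOn ℝ n (fun p => (ContinuousLinearMap.fst ℝ ℝ ℝ).smulRight (A p (W p)) +
        (ContinuousLinearMap.snd ℝ ℝ ℝ).smulRight (B p (W p))) s :=
      (contDiffOn_const.smulRight ((hA.of_le hn).clm_apply ih)).add
        (contDiffOn_const.smulRight ((hB.of_le hn).clm_apply ih))
    refine h1.congr fun p hp => ?_
    rw [(hW p hp).fderiv]
    ext <;> simp

lemma hasDerivAt_right {f : ℝ × ℝ → V} {u v : ℝ} (hf : DifferentiableAt ℝ f (u, v)) :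
    HasDerivAt (fun t => f (u, t)) (pv f (u, v)) v :=
  hf.hasFDerivAt.comp_hasDerivAt v ((hasDerivAt_const v u).prodMk (hasDerivAt_id v))

lemma hasDerivAt_left {f : ℝ × ℝ → V} {u v : ℝ} (hf : DifferentiableAt ℝ f (u, v)) :
    HasDerivAt (fun t => f (t, v)) (pu f (u, v)) u :=
  hf.hasFDerivAt.comp_hasDerivAt u ((hasDerivAt_id u).prodMk (hasDerivAt_const u v))

/-- Solvability of a compatible linear total differential system on a small square, with explicit
bounds for the coefficients. -/
lemma exists_solution_of_bounds [CompleteSpace V] {A B : ℝ × ℝ → V →L[ℝ] V} {q : ℝ × ℝ}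
    {ε M : ℝ} (hε : 0 < ε) (hM : 1 ≤ M) (hMε : M * ε ≤ 1 / 2)
    (hA : ∀ p ∈ closedBall q ε, DifferentiableAt ℝ A p)
    (hB : ∀ p ∈ closedBall q ε, DifferentiableAt ℝ B p)
    (hAM : ∀ p ∈ closedBall q ε, ‖A p‖ ≤ M) (hBM : ∀ p ∈ closedBall q ε, ‖B p‖ ≤ M)
    (hBL : ∀ p ∈ closedBall q ε, ∀ p' ∈ closedBall q ε, ‖B p' - B p‖ ≤ M * ‖p' - p‖)
    (hBL' : ∀ p ∈ closedBall q ε, ∀ p' ∈ closedBall q ε,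
      ‖fderiv ℝ B p' - fderiv ℝ B p‖ ≤ M * ‖p' - p‖)
    (hAB : ∀ p ∈ closedBall q ε, pv A p + A p ∘L B p = pu B p + B p ∘L A p) (w : V) :
    ∃ W : ℝ × ℝ → V, W q = w ∧ ∀ p ∈ ball q ε, HasFDerivAt W
      ((ContinuousLinearMap.toSpanSingleton ℝ (A p (W p))).coprod
        (ContinuousLinearMap.toSpanSingleton ℝ (B p (W p)))) p := by
  obtain ⟨a, b⟩ := q
  set I := Icc (a - ε) (a + ε) with hI
  set J := Icc (b - ε) (b + ε) with hJ
  have hK : ∀ {u v : ℝ}, u ∈ I → v ∈ J → (u, v) ∈ closedBall (a, b) ε := fun hu hv =>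
    mem_closedBall_prod_iff.mpr ⟨hu, hv⟩
  have hbJ : b ∈ J := ⟨by linarith, by linarith⟩
  have haI : a ∈ I := ⟨by linarith, by linarith⟩
  have hM0 : 0 ≤ M := by linarith
  have hw := norm_nonneg w
  -- Integrate first along the horizontal line through the centre, then along every vertical line
  -- starting from the values found. The `v`-equation holds by construction; the `u`-equation off
  -- the horizontal line is what compatibility must supply.
  obtain ⟨X, hX0, hX⟩ := exists_solution_linear (B := fun u => A (u, b)) (c := a) hM0 hε.le hMε
    (fun u hu => (hasDerivAt_left (hA _ (hK hu hbJ))).continuousAt.continuousWithinAt)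
    (fun u hu => hAM _ (hK hu hbJ)) w
  have hY : ∀ u, ∃ y : ℝ → V, u ∈ I → y b = X u ∧
      ∀ t ∈ J, HasDerivWithinAt y (B (u, t) (y t)) J t := by
    intro u
    by_cases hu : u ∈ I
    · obtain ⟨y, hy⟩ := exists_solution_linear (B := fun t => B (u, t)) (c := b) hM0 hε.le hMε
        (fun t ht => (hasDerivAt_right (hB _ (hK hu ht))).continuousAt.continuousWithinAt)
        (fun t ht => hBM _ (hK hu ht)) (X u)
      exact ⟨y, fun _ => hy⟩
    · exact ⟨0, fun h => absurd h hu⟩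
  choose Y hY using hY
  set k := Real.exp (M * ε) with hk
  have hk1 : 1 ≤ k := Real.one_le_exp (by positivity)
  set N := ‖w‖ * k * k with hN
  have hN0 : 0 ≤ N := by positivity
  have hXN : ∀ u ∈ I, ‖X u‖ ≤ ‖w‖ * k := by
    intro u hu
    have := norm_le_mul_exp (e := 0) hM hε.le le_rfl hX (by rw [hX0]) (fun t ht => by
      rw [add_zero]
      exact (A (t, b)).le_of_opNorm_le (hAM _ (hK ht hbJ)) _) u hu
    simpa using this
  have hYN : ∀ u ∈ I, ∀ v ∈ J, ‖Y u v‖ ≤ N := by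
    intro u hu v hv
    have := norm_le_mul_exp (δ := ‖w‖ * k) (e := 0) hM hε.le le_rfl (hY u hu).2
      (by rw [(hY u hu).1]; exact hXN u hu) (fun t ht => by
        rw [add_zero]
        exact (B (u, t)).le_of_opNorm_le (hBM _ (hK hu ht)) _) v hv
    simpa using this
  have hXL : ∀ u ∈ I, ∀ u' ∈ I, ‖X u' - X u‖ ≤ M * N * |u' - u| := by
    intro u hu u' hu'
    refine Convex.norm_image_sub_le_of_norm_hasDerivWithin_le hX (fun t ht => ?_)
      (convex_Icc _ _) hu hu'
    refine ((A (t, b)).le_of_opNorm_le (hAM _ (hK ht hbJ)) _).trans ?_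
    gcongr
    rw [← (hY t ht).1]
    exact hYN t ht b hbJ
  have hdist : ∀ u u' v : ℝ, ‖((u', v) : ℝ × ℝ) - (u, v)‖ = |u' - u| := by
    intro u u' v
    simp [Prod.norm_def]
  set C := (M * N + M * N) * k with hC
  have hC0 : 0 ≤ C := by positivity
  have hYL : ∀ v ∈ J, ∀ u ∈ I, ∀ u' ∈ I, ‖Y u' v - Y u v‖ ≤ C * |u' - u| := by
    intro v hv u hu u' hu'
    have := norm_le_mul_exp (f := fun t => Y u' t - Y u t) (δ := M * N * |u' - u|)
      (e := M * N * |u' - u|) hM hε.le (by positivity)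
      (fun t ht => ((hY u' hu').2 t ht).sub ((hY u hu).2 t ht))
      (by simp only [(hY u' hu').1, (hY u hu).1]; exact hXL u hu u' hu')
      (fun t ht => by
        have h1 := (B (u', t)).le_of_opNorm_le (hBM _ (hK hu' ht)) (Y u' t - Y u t)
        have h2 : ‖(B (u', t) - B (u, t)) (Y u t)‖ ≤ M * |u' - u| * N := by
          have h3 := hBL _ (hK hu ht) _ (hK hu' ht)
          rw [hdist] at h3
          refine ((B (u', t) - B (u, t)).le_of_opNorm_le h3 _).trans ?_
          gcongr
          exact hYN u hu t ht
        have h4 : B (u', t) (Y u' t) - B (u, t) (Y u t) =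
            B (u', t) (Y u' t - Y u t) + (B (u', t) - B (u, t)) (Y u t) := by
          simp
        rw [h4]
        refine (norm_add_le _ _).trans ?_
        linarith) v hv
    refine this.trans (le_of_eq ?_)
    rw [hC]
    ring
  -- The defect `R(t) = Y(u+h,t) - Y(u,t) - hA(u,t)Y(u,t)` is `o(h)` at `t = b`. Compatibility turns
  -- its derivative into `BR + O(h²)`, so Grönwall keeps it `o(h)` along the whole vertical line.
  have hYu : ∀ u ∈ Ioo (a - ε) (a + ε), ∀ v ∈ J,
      HasDerivAt (fun s => Y s v) (A (u, v) (Y u v)) u := by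
    intro u hu v hv
    have huI : u ∈ I := Ioo_subset_Icc_self hu
    rw [hasDerivAt_iff_isLittleO_nhds_zero, Asymptotics.isLittleO_iff]
    intro c hc
    -- Initial defect and inhomogeneity will each be at most `η|h|`, and Grönwall multiplies their
    -- sum by `k`, which gives `c|h|`.
    set η := c / (2 * k) with hη
    have hη0 : 0 < η := by positivity
    have hX' : HasDerivAt X (A (u, b) (X u)) u :=
      (hX u huI).hasDerivAt (Icc_mem_nhds hu.1 hu.2)
    rw [hasDerivAt_iff_isLittleO_nhds_zero, Asymptotics.isLittleO_iff] at hX'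
    have e1 : ∀ᶠ h : ℝ in nhds 0, u + h ∈ I := by
      have : Filter.Tendsto (fun h : ℝ => u + h) (nhds 0) (nhds u) := by
        simpa using (continuous_const_add u).tendsto (0 : ℝ)
      exact this.eventually (Icc_mem_nhds hu.1 hu.2)
    have e2 : ∀ᶠ h : ℝ in nhds 0, |h| * (M * C + M * N) ≤ η := by
      have : Filter.Tendsto (fun h : ℝ => |h| * (M * C + M * N)) (nhds 0) (nhds 0) := by
        have : Continuous (fun h : ℝ => |h| * (M * C + M * N)) := by fun_prop
        simpa using this.tendsto 0
      exact (this.eventually (gt_mem_nhds hη0)).mono fun _ h => le_of_lt h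
    filter_upwards [e1, e2, hX' hη0] with h h1 h2 h3
    have hAv : ∀ t ∈ J, HasDerivWithinAt (fun t => A (u, t) (Y u t))
        (pv A (u, t) (Y u t) + A (u, t) (B (u, t) (Y u t))) J t := fun t ht =>
      (hasDerivAt_right (hA _ (hK huI ht))).hasDerivWithinAt.clm_apply ((hY u huI).2 t ht)
    have := norm_le_mul_exp (f := fun t => Y (u + h) t - Y u t - h • A (u, t) (Y u t))
      (δ := η * ‖h‖) (e := η * ‖h‖) hM hε.le (by positivity)
      (fun t ht => (((hY _ h1).2 t ht).sub ((hY u huI).2 t ht)).sub ((hAv t ht).const_smul h))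
      (by simpa only [(hY _ h1).1, (hY u huI).1] using h3)
      (fun t ht => by
        have hcomp : pv A (u, t) (Y u t) + A (u, t) (B (u, t) (Y u t)) =
            pu B (u, t) (Y u t) + B (u, t) (A (u, t) (Y u t)) := by
          simpa using congrArg (fun T : V →L[ℝ] V => T (Y u t)) (hAB _ (hK huI ht))
        have g1 := (B (u, t)).le_of_opNorm_le (hBM _ (hK huI ht))
          (Y (u + h) t - Y u t - h • A (u, t) (Y u t))
        have g2 : ‖(B (u + h, t) - B (u, t)) (Y (u + h) t - Y u t)‖ ≤
            M * |h| * (C * |h|) := by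
          have g3 := hBL _ (hK huI ht) _ (hK h1 ht)
          rw [hdist, add_sub_cancel_left] at g3
          refine ((B (u + h, t) - B (u, t)).le_of_opNorm_le g3 _).trans ?_
          gcongr
          simpa using hYL t ht u huI _ h1
        have g4 : ‖(B (u + h, t) - B (u, t) - h • pu B (u, t)) (Y u t)‖ ≤ M * |h| * |h| * N := by
          refine ((B (u + h, t) - B (u, t) - h • pu B (u, t)).le_of_opNorm_le
            (norm_sub_sub_smul_pu_le hB hM0 hBL' (hK huI ht) (hK h1 ht)) _).trans ?_
          gcongr
          exact hYN u huI t ht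
        -- The last two summands are quadratic in `h`: a product of two increments, and the Taylor
        -- remainder of `B`.
        have g5 : B (u + h, t) (Y (u + h) t) - B (u, t) (Y u t) -
            h • (pv A (u, t) (Y u t) + A (u, t) (B (u, t) (Y u t))) =
            B (u, t) (Y (u + h) t - Y u t - h • A (u, t) (Y u t)) +
            (B (u + h, t) - B (u, t)) (Y (u + h) t - Y u t) +
            (B (u + h, t) - B (u, t) - h • pu B (u, t)) (Y u t) := by
          rw [hcomp]
          simp only [map_sub, map_smul, sub_apply,
            smul_apply, smul_add]
          abel
        rw [g5]
        refine (norm_add_le _ _).trans ((add_le_add (norm_add_le _ _) le_rfl).trans ?_)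
        have g6 : M * |h| * (C * |h|) + M * |h| * |h| * N = |h| * (M * C + M * N) * |h| := by ring
        have g7 : |h| * (M * C + M * N) * |h| ≤ η * |h| := by gcongr
        rw [Real.norm_eq_abs]
        linarith) v hv
    refine this.trans (le_of_eq ?_)
    rw [hη, ← hk]
    field_simp
    ring
  -- Joint continuity makes both partial derivatives continuous, and continuous partials give total
  -- differentiability.
  have hWc : ContinuousOn (fun p : ℝ × ℝ => Y p.1 p.2) (I ×ˢ J) := by
    refine continuousOn_prod_of_continuousOn_lipschitzOnWith _ ⟨C, hC0⟩
      (fun u hu t ht => ((hY u hu).2 t ht).continuousWithinAt) (fun v hv => ?_)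
    refine LipschitzOnWith.of_dist_le_mul fun u' hu' u hu => ?_
    rw [dist_eq_norm, Real.dist_eq]
    exact hYL v hv u hu u' hu'
  refine ⟨fun p => Y p.1 p.2, by simp only; rw [(hY a haI).1, hX0], ?_⟩
  intro p hp
  have hball : ∀ {p : ℝ × ℝ}, p ∈ ball (a, b) ε →
      p.1 ∈ Ioo (a - ε) (a + ε) ∧ p.2 ∈ Ioo (b - ε) (b + ε) := by
    intro p hp
    rwa [← ball_prod_same, mem_prod, Real.ball_eq_Ioo, Real.ball_eq_Ioo] at hp
  have hnhds : ball (a, b) ε ∈ nhds p := isOpen_ball.mem_nhds hp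
  have hWp : ContinuousAt (fun p : ℝ × ℝ => Y p.1 p.2) p :=
    hWc.continuousAt (Filter.mem_of_superset hnhds fun p hp =>
      ⟨Ioo_subset_Icc_self (hball hp).1, Ioo_subset_Icc_self (hball hp).2⟩)
  have hcont : ∀ {T : ℝ × ℝ → V →L[ℝ] V}, (∀ p ∈ closedBall (a, b) ε, DifferentiableAt ℝ T p) →
      ContinuousAt (fun p : ℝ × ℝ =>
        ContinuousLinearMap.toSpanSingleton ℝ (T p (Y p.1 p.2))) p := by
    intro T hT
    exact (ContinuousLinearMap.toSpanSingletonCLE (𝕜 := ℝ) (E := V)).continuous.continuousAt.comp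
      ((hT p (ball_subset_closedBall hp)).continuousAt.clm_apply hWp)
  have := hasStrictFDerivAt_uncurry_coprod (𝕜 := ℝ) (u := p) (f := Y)
    (f₁ := fun u v => ContinuousLinearMap.toSpanSingleton ℝ (A (u, v) (Y u v)))
    (f₂ := fun u v => ContinuousLinearMap.toSpanSingleton ℝ (B (u, v) (Y u v)))
    (Filter.mem_of_superset hnhds fun p hp => ?_)
    (Filter.mem_of_superset hnhds fun p hp => ?_) (hcont hA) (hcont hB)
  · exact this.hasFDerivAt
  · exact (hYu p.1 (hball hp).1 p.2 (Ioo_subset_Icc_self (hball hp).2)).hasFDerivAt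
  · exact (((hY p.1 (Ioo_subset_Icc_self (hball hp).1)).2 p.2
      (Ioo_subset_Icc_self (hball hp).2)).hasDerivAt
        (Icc_mem_nhds (hball hp).2.1 (hball hp).2.2)).hasFDerivAt

/-- Local solvability of a compatible linear total differential system with smooth
coefficients. -/
theorem exists_solution_of_compatible [CompleteSpace V] {A B : ℝ × ℝ → V →L[ℝ] V}
    {U : Set (ℝ × ℝ)} (hU : IsOpen U) (hA : ContDiffOn ℝ ∞ A U) (hB : ContDiffOn ℝ ∞ B U)
    (hAB : ∀ p ∈ U, pv A p + A p ∘L B p = pu B p + B p ∘L A p) {q : ℝ × ℝ} (hq : q ∈ U) (w : V) :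
    ∃ ε > 0, ball q ε ⊆ U ∧ ∃ W : ℝ × ℝ → V, W q = w ∧ ContDiffOn ℝ ∞ W (ball q ε) ∧
      ∀ p ∈ ball q ε, pu W p = A p (W p) ∧ pv W p = B p (W p) := by
  have hUq : U ∈ nhds q := hU.mem_nhds hq
  have hle : (1 : WithTop ℕ∞) ≤ ∞ := by exact_mod_cast le_top
  have h2le : (1 : WithTop ℕ∞) + 1 ≤ ∞ := by
    rw [one_add_one_eq_two]
    exact WithTop.coe_le_coe.mpr (le_top : (2 : ℕ∞) ≤ ⊤)
  obtain ⟨M₁, r₁, hr₁, h₁⟩ := exists_bounds_of_contDiffAt ((hA.contDiffAt hUq).of_le hle)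
  obtain ⟨M₂, r₂, hr₂, h₂⟩ := exists_bounds_of_contDiffAt ((hB.contDiffAt hUq).of_le hle)
  obtain ⟨M₃, r₃, hr₃, h₃⟩ := exists_bounds_of_contDiffAt
    ((hB.contDiffAt hUq).fderiv_right (m := 1) h2le)
  obtain ⟨r₄, hr₄, h₄⟩ := nhds_basis_closedBall.mem_iff.mp hUq
  set M := max 1 (max M₁ (max M₂ M₃)) with hM
  have hM1 : 1 ≤ M := le_max_left _ _
  have hM₁ : M₁ ≤ M := (le_max_left _ _).trans (le_max_right _ _)
  have hM₂ : M₂ ≤ M := (le_max_left _ _).trans ((le_max_right _ _).trans (le_max_right _ _))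
  have hM₃ : M₃ ≤ M := (le_max_right _ _).trans ((le_max_right _ _).trans (le_max_right _ _))
  -- The first term secures the time restriction `Mε ≤ 1/2`, the others the domains of the bounds
  -- for `A`, `B`, the derivative of `B`, and containment in `U`.
  set ε := min (1 / (2 * M)) (min r₁ (min r₂ (min r₃ r₄))) with hε
  have hε0 : 0 < ε := by positivity
  have hMε : M * ε ≤ 1 / 2 := by
    calc M * ε ≤ M * (1 / (2 * M)) := by gcongr; exact min_le_left _ _
      _ = 1 / 2 := by field_simp
  have s₁ : closedBall q ε ⊆ closedBall q r₁ := closedBall_subset_closedBall (by simp [hε])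
  have s₂ : closedBall q ε ⊆ closedBall q r₂ := closedBall_subset_closedBall (by simp [hε])
  have s₃ : closedBall q ε ⊆ closedBall q r₃ := closedBall_subset_closedBall (by simp [hε])
  have s₄ : closedBall q ε ⊆ U :=
    (closedBall_subset_closedBall (by simp [hε])).trans h₄
  have hd : ∀ {T : ℝ × ℝ → V →L[ℝ] V}, ContDiffOn ℝ ∞ T U → ∀ p ∈ closedBall q ε,
      DifferentiableAt ℝ T p := fun hT p hp =>
    (hT.contDiffAt (hU.mem_nhds (s₄ hp))).differentiableAt (by simp)
  obtain ⟨W, hW0, hW⟩ := exists_solution_of_bounds hε0 hM1 hMε (hd hA) (hd hB)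
    (fun p hp => ((h₁ p (s₁ hp)).1).trans hM₁) (fun p hp => ((h₂ p (s₂ hp)).1).trans hM₂)
    (fun p hp p' hp' => ((h₂ p (s₂ hp)).2 p' (s₂ hp')).trans (by gcongr))
    (fun p hp p' hp' => ((h₃ p (s₃ hp)).2 p' (s₃ hp')).trans (by gcongr))
    (fun p hp => hAB p (s₄ hp)) w
  have hsub : ball q ε ⊆ U := ball_subset_closedBall.trans s₄
  refine ⟨ε, hε0, hsub, W, hW0, contDiffOn_of_hasFDerivAt_coprod isOpen_ball (hA.mono hsub)
    (hB.mono hsub) hW, fun p hp => ?_⟩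
  simp [pu, pv, (hW p hp).fderiv]

end LinearSystem

/-! ### Systems with scalar matrix coefficients acting on families of vectors. -/

section MatrixSystem

open Set Metric

variable {ι : Type*} [Fintype ι] [DecidableEq ι] {E : Type*} [NormedAddCommGroup E]
  [NormedSpace ℝ E]

/-- The operator on families of vectors given by a matrix of scalars. -/
def matrixCLM (E : Type*) [NormedAddCommGroup E] [NormedSpace ℝ E] (m : ι → ι → ℝ) :
    (ι → E) →L[ℝ] (ι → E) :=
  ∑ i, ∑ j, m i j • (ContinuousLinearMap.single ℝ (fun _ : ι => E) i ∘L
    ContinuousLinearMap.proj (R := ℝ) (φ := fun _ : ι => E) j)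

lemma matrixCLM_apply (m : ι → ι → ℝ) (w : ι → E) (i : ι) :
    matrixCLM E m w i = ∑ j, m i j • w j := by
  simp only [matrixCLM, sum_apply, smul_apply, ContinuousLinearMap.comp_apply,
    Finset.sum_apply, Pi.smul_apply, ContinuousLinearMap.single_apply, Pi.single_apply,
    ContinuousLinearMap.proj_apply, smul_ite, smul_zero]
  rw [Finset.sum_eq_single i (fun k _ hk => by simp [hk.symm]) (by simp)]
  simp

lemma contDiffOn_matrixCLM {a : ι → ι → ℝ × ℝ → ℝ} {U : Set (ℝ × ℝ)}
    (ha : ∀ i j, ContDiffOn ℝ ∞ (a i j) U) :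
    ContDiffOn ℝ ∞ (fun p => matrixCLM E fun i j => a i j p) U :=
  ContDiffOn.sum fun i _ => ContDiffOn.sum fun j _ => (ha i j).smul contDiffOn_const

lemma fderiv_matrixCLM {a : ι → ι → ℝ × ℝ → ℝ} {p : ℝ × ℝ}
    (ha : ∀ i j, DifferentiableAt ℝ (a i j) p) (X : ℝ × ℝ) :
    fderiv ℝ (fun p => matrixCLM E fun i j => a i j p) p X =
      matrixCLM E fun i j => fderiv ℝ (a i j) p X := by
  have : HasFDerivAt (fun p => matrixCLM E fun i j => a i j p)
      (∑ i, ∑ j, (fderiv ℝ (a i j) p).smulRight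
        (ContinuousLinearMap.single ℝ (fun _ : ι => E) i ∘L
          ContinuousLinearMap.proj (R := ℝ) (φ := fun _ : ι => E) j)) p :=
    HasFDerivAt.fun_sum fun i _ => HasFDerivAt.fun_sum fun j _ =>
      (ha i j).hasFDerivAt.smul_const (ContinuousLinearMap.single ℝ (fun _ : ι => E) i ∘L
        ContinuousLinearMap.proj (R := ℝ) (φ := fun _ : ι => E) j)
  rw [this.fderiv]
  simp [matrixCLM]

/-- Local solvability of a compatible linear total differential system given by matrices of smooth
functions. -/
theorem exists_solution_of_matrix_compatible [CompleteSpace E] {a b : ι → ι → ℝ × ℝ → ℝ}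
    {U : Set (ℝ × ℝ)} (hU : IsOpen U) (ha : ∀ i j, ContDiffOn ℝ ∞ (a i j) U)
    (hb : ∀ i j, ContDiffOn ℝ ∞ (b i j) U)
    (hab : ∀ p ∈ U, ∀ i j, pv (a i j) p + ∑ k, a i k p * b k j p =
      pu (b i j) p + ∑ k, b i k p * a k j p) {q : ℝ × ℝ} (hq : q ∈ U) (w : ι → E) :
    ∃ ε > 0, ball q ε ⊆ U ∧ ∃ W : ι → ℝ × ℝ → E, (∀ i, W i q = w i) ∧
      (∀ i, ContDiffOn ℝ ∞ (W i) (ball q ε)) ∧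
      ∀ p ∈ ball q ε, ∀ i, pu (W i) p = ∑ j, a i j p • W j p ∧
        pv (W i) p = ∑ j, b i j p • W j p := by
  have hd : ∀ {f : ℝ × ℝ → ℝ}, ContDiffOn ℝ ∞ f U → ∀ p ∈ U, DifferentiableAt ℝ f p :=
    fun hf p hp => (hf.contDiffAt (hU.mem_nhds hp)).differentiableAt (by simp)
  obtain ⟨ε, hε, hsub, W, hW0, hW, hWd⟩ := exists_solution_of_compatible
    (V := ι → E) hU (contDiffOn_matrixCLM (E := E) ha) (contDiffOn_matrixCLM (E := E) hb)
    (fun p hp => by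
      ext1 w
      funext i
      simp only [pu, pv, fderiv_matrixCLM (E := E) (fun i j => hd (ha i j) p hp),
        fderiv_matrixCLM (E := E) (fun i j => hd (hb i j) p hp), add_apply,
        ContinuousLinearMap.comp_apply, Pi.add_apply, matrixCLM_apply, Finset.smul_sum, smul_smul]
      -- After exchanging the sums both sides are combinations of the `w j`, and the coefficients
      -- agree by the entrywise condition.
      rw [Finset.sum_comm (γ := ι), Finset.sum_comm (γ := ι) (s := Finset.univ) (t := Finset.univ)
        (f := fun k j => (b i k p * a k j p) • w j)]
      simp only [← Finset.sum_smul, ← Finset.sum_add_distrib, ← add_smul]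
      exact Finset.sum_congr rfl fun j _ => congrArg (· • w j) (hab p hp i j)) hq w
  refine ⟨ε, hε, hsub, fun i p => W p i, fun i => by simp only [hW0],
    fun i => contDiffOn_pi.mp hW i, fun p hp i => ?_⟩
  have hWp : DifferentiableAt ℝ W p :=
    (hW.contDiffAt (isOpen_ball.mem_nhds hp)).differentiableAt (by simp)
  have hX : ∀ X, fderiv ℝ (fun p => W p i) p X = fderiv ℝ W p X i := fun X => by
    have := ((ContinuousLinearMap.proj (R := ℝ) (φ := fun _ : ι => E) i).hasFDerivAt.comp p
      hWp.hasFDerivAt).fderiv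
    exact congrArg (fun T : ℝ × ℝ →L[ℝ] E => T X) this
  have h := hWd p hp
  simp only [pu, pv] at h ⊢
  rw [hX, hX, h.1, h.2, matrixCLM_apply, matrixCLM_apply]
  exact ⟨rfl, rfl⟩

end MatrixSystem

/-! ### Functions with vanishing partial derivatives. -/

section Constancy

variable {V : Type*} [NormedAddCommGroup V] [NormedSpace ℝ V] {D : Set (ℝ × ℝ)}

lemma fderiv_apply_eq (f : ℝ × ℝ → V) (p X : ℝ × ℝ) :
    fderiv ℝ f p X = X.1 • pu f p + X.2 • pv f p := by
  rw [pu, pv, ← map_smul, ← map_smul, ← map_add]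
  simp

lemma eq_of_partials_eq_zero (hD : IsOpen D) (hc : IsPreconnected D) {f : ℝ × ℝ → V}
    (hf : DifferentiableOn ℝ f D) (hu : ∀ p ∈ D, pu f p = 0) (hv : ∀ p ∈ D, pv f p = 0)
    {p q : ℝ × ℝ} (hp : p ∈ D) (hq : q ∈ D) : f p = f q := by
  refine hD.is_const_of_fderiv_eq_zero (𝕜 := ℝ) hc hf (fun r hr => ?_) hp hq
  refine ContinuousLinearMap.ext fun X => ?_
  simp [fderiv_apply_eq, hu r hr, hv r hr]

end Constancy

/-! ### The moving frame system: integrability, conserved quantity and uniqueness. -/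

section StructureEquations

open Set Metric

/-- The structure equations of an isothermally parametrized surface `z` with conformal factor
`phi` and a frame field `x`, `y`, `b`, `l` along it, where `b` is parallel. -/
structure StructureEquations (D : Set (ℝ × ℝ)) (phi A C n m k : ℝ × ℝ → ℝ)
    (z x y b l : ℝ × ℝ → E4) : Prop where
  smooth_z : ContDiffOn ℝ ∞ z D
  smooth_x : ContDiffOn ℝ ∞ x D
  smooth_y : ContDiffOn ℝ ∞ y D
  smooth_b : ContDiffOn ℝ ∞ b D
  smooth_l : ContDiffOn ℝ ∞ l D
  z_u : ∀ p ∈ D, pu z p = phi p • x p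
  z_v : ∀ p ∈ D, pv z p = phi p • y p
  x_u : ∀ p ∈ D, pu x p = C p • y p + n p • b p
  x_v : ∀ p ∈ D, pv x p = -A p • y p + m p • b p + k p • l p
  y_u : ∀ p ∈ D, pu y p = -C p • x p + m p • b p + k p • l p
  y_v : ∀ p ∈ D, pv y p = A p • x p + n p • b p
  b_u : ∀ p ∈ D, pu b p = -n p • x p + -m p • y p
  b_v : ∀ p ∈ D, pv b p = -m p • x p + -n p • y p
  l_u : ∀ p ∈ D, pu l p = -k p • y p
  l_v : ∀ p ∈ D, pv l p = -k p • x p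

lemma fderiv_u {V : Type*} [NormedAddCommGroup V] [NormedSpace ℝ V] (f : ℝ × ℝ → V)
    (p : ℝ × ℝ) : fderiv ℝ f p (1, 0) = pu f p := rfl

lemma fderiv_v {V : Type*} [NormedAddCommGroup V] [NormedSpace ℝ V] (f : ℝ × ℝ → V)
    (p : ℝ × ℝ) : fderiv ℝ f p (0, 1) = pv f p := rfl

lemma pu_neg' (f : ℝ × ℝ → ℝ) (p : ℝ × ℝ) : pu (-f) p = -pu f p := by
  simp [pu, fderiv_neg]

lemma pv_neg' (f : ℝ × ℝ → ℝ) (p : ℝ × ℝ) : pv (-f) p = -pv f p := by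
  simp [pv, fderiv_neg]

lemma pu_zero (p : ℝ × ℝ) : pu (0 : ℝ × ℝ → ℝ) p = 0 := by
  simp [pu]

lemma pv_zero (p : ℝ × ℝ) : pv (0 : ℝ × ℝ → ℝ) p = 0 := by
  simp [pv]

/-- The equations of Gauss, Codazzi and Ricci are sufficient for the local solvability of the
structure equations. -/
theorem exists_structureEquations {U : Set (ℝ × ℝ)} (hU : IsOpen U) {phi A C n m k : ℝ × ℝ → ℝ}
    (hphi : ContDiffOn ℝ ∞ phi U) (hA : ContDiffOn ℝ ∞ A U) (hC : ContDiffOn ℝ ∞ C U)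
    (hn : ContDiffOn ℝ ∞ n U) (hm : ContDiffOn ℝ ∞ m U) (hk : ContDiffOn ℝ ∞ k U)
    (phi_u : ∀ p ∈ U, pu phi p = -A p * phi p) (phi_v : ∀ p ∈ U, pv phi p = -C p * phi p)
    (k_u : ∀ p ∈ U, pu k p = A p * k p) (k_v : ∀ p ∈ U, pv k p = C p * k p)
    (n_u : ∀ p ∈ U, pu n p = pv m p - C p * m p - A p * n p)
    (n_v : ∀ p ∈ U, pv n p = pu m p - A p * m p - C p * n p)
    (gauss : ∀ p ∈ U, pu A p + pv C p = n p ^ 2 - m p ^ 2 - k p ^ 2)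
    {q : ℝ × ℝ} (hq : q ∈ U) (z₀ x₀ y₀ b₀ l₀ : E4) :
    ∃ ε > 0, ball q ε ⊆ U ∧ ∃ z x y b l : ℝ × ℝ → E4,
      StructureEquations (ball q ε) phi A C n m k z x y b l ∧
      z q = z₀ ∧ x q = x₀ ∧ y q = y₀ ∧ b q = b₀ ∧ l q = l₀ := by
  have h0 : ContDiffOn ℝ ∞ (0 : ℝ × ℝ → ℝ) U := contDiffOn_const
  obtain ⟨ε, hε, hsub, W, hW0, hW, hWd⟩ := exists_solution_of_matrix_compatible
    -- Rows and columns are ordered `z, x, y, b, l`; the lower right `4 × 4` blocks of both matrices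
    -- are skew-symmetric.
    (a := ![![0, phi, 0, 0, 0], ![0, 0, C, n, 0], ![0, -C, 0, m, k], ![0, -n, -m, 0, 0],
      ![0, 0, -k, 0, 0]])
    (b := ![![0, 0, phi, 0, 0], ![0, 0, -A, m, k], ![0, A, 0, n, 0], ![0, -m, -n, 0, 0],
      ![0, -k, 0, 0, 0]]) hU
    (by
      intro i j
      fin_cases i <;> fin_cases j <;>
        first | exact h0 | exact hphi | exact hA | exact hC | exact hn | exact hm | exact hk
              | exact hC.neg | exact hn.neg | exact hm.neg | exact hk.neg)
    (by
      intro i j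
      fin_cases i <;> fin_cases j <;>
        first | exact h0 | exact hphi | exact hA | exact hC | exact hn | exact hm | exact hk
              | exact hA.neg | exact hn.neg | exact hm.neg | exact hk.neg)
    (by
      -- The row of `z` gives the equations for `phi`, the pair `x, y` Gauss, the pairs with `b` or
      -- `l` and a tangent vector Codazzi; the pair `b, l` (Ricci) is an identity.
      intro p hp i j
      have e1 := phi_u p hp
      have e2 := phi_v p hp
      have e3 := k_u p hp
      have e4 := k_v p hp
      have e5 := n_u p hp
      have e6 := n_v p hp
      have e7 := gauss p hp
      fin_cases i <;> fin_cases j <;>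
        simp [Fin.sum_univ_succ, pu_zero, pv_zero, pu_neg', pv_neg'] <;> linarith)
    hq ![z₀, x₀, y₀, b₀, l₀]
  refine ⟨ε, hε, hsub, W 0, W 1, W 2, W 3, W 4,
    ⟨hW 0, hW 1, hW 2, hW 3, hW 4, ?_, ?_, ?_, ?_, ?_, ?_, ?_, ?_, ?_, ?_⟩,
    hW0 0, hW0 1, hW0 2, hW0 3, hW0 4⟩
  · intro p hp
    simpa [Fin.sum_univ_succ] using (hWd p hp 0).1
  · intro p hp
    simpa [Fin.sum_univ_succ] using (hWd p hp 0).2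
  · intro p hp
    simpa [Fin.sum_univ_succ] using (hWd p hp 1).1
  · intro p hp
    simpa [Fin.sum_univ_succ, add_assoc] using (hWd p hp 1).2
  · intro p hp
    simpa [Fin.sum_univ_succ, add_assoc] using (hWd p hp 2).1
  · intro p hp
    simpa [Fin.sum_univ_succ] using (hWd p hp 2).2
  · intro p hp
    simpa [Fin.sum_univ_succ] using (hWd p hp 3).1
  · intro p hp
    simpa [Fin.sum_univ_succ] using (hWd p hp 3).2
  · intro p hp
    simpa [Fin.sum_univ_succ] using (hWd p hp 4).1
  · intro p hp
    simpa [Fin.sum_univ_succ] using (hWd p hp 4).2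

variable {V : Type*} [NormedAddCommGroup V] [InnerProductSpace ℝ V]

lemma fderiv_inner_eq {f h : ℝ × ℝ → V} {p : ℝ × ℝ} (hf : DifferentiableAt ℝ f p)
    (hh : DifferentiableAt ℝ h p) (X : ℝ × ℝ) :
    fderiv ℝ (fun q => inner ℝ (f q) (h q)) p X =
      inner ℝ (f p) (fderiv ℝ h p X) + inner ℝ (fderiv ℝ f p X) (h p) :=
  fderiv_inner_apply ℝ hf hh X

lemma fderiv_smul_eq {s : ℝ × ℝ → ℝ} {f : ℝ × ℝ → V} {p : ℝ × ℝ} (hs : DifferentiableAt ℝ s p)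
    (hf : DifferentiableAt ℝ f p) (X : ℝ × ℝ) :
    fderiv ℝ (fun q => s q • f q) p X = s p • fderiv ℝ f p X + fderiv ℝ s p X • f p := by
  rw [fderiv_fun_smul hs hf]
  simp

namespace StructureEquations

variable {D : Set (ℝ × ℝ)} {phi A C n m k : ℝ × ℝ → ℝ} {z x y b l z' x' y' b' l' : ℝ × ℝ → E4}

lemma differentiableAt (hD : IsOpen D) {f : ℝ × ℝ → V} (hf : ContDiffOn ℝ ∞ f D) {p : ℝ × ℝ}
    (hp : p ∈ D) : DifferentiableAt ℝ f p :=
  (hf.contDiffAt (hD.mem_nhds hp)).differentiableAt (by simp)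

/-- The structure equations are linear. -/
theorem sub (h : StructureEquations D phi A C n m k z x y b l)
    (h' : StructureEquations D phi A C n m k z' x' y' b' l') (hD : IsOpen D) :
    StructureEquations D phi A C n m k (z - z') (x - x') (y - y') (b - b') (l - l') := by
  have hu : ∀ {f f' : ℝ × ℝ → E4}, ContDiffOn ℝ ∞ f D → ContDiffOn ℝ ∞ f' D → ∀ p ∈ D,
      pu (f - f') p = pu f p - pu f' p := fun hf hf' p hp => by
    simp [pu, fderiv_sub (differentiableAt hD hf hp) (differentiableAt hD hf' hp)]
  have hv : ∀ {f f' : ℝ × ℝ → E4}, ContDiffOn ℝ ∞ f D → ContDiffOn ℝ ∞ f' D → ∀ p ∈ D,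
      pv (f - f') p = pv f p - pv f' p := fun hf hf' p hp => by
    simp [pv, fderiv_sub (differentiableAt hD hf hp) (differentiableAt hD hf' hp)]
  refine ⟨h.smooth_z.sub h'.smooth_z, h.smooth_x.sub h'.smooth_x, h.smooth_y.sub h'.smooth_y,
    h.smooth_b.sub h'.smooth_b, h.smooth_l.sub h'.smooth_l, ?_, ?_, ?_, ?_, ?_, ?_, ?_, ?_, ?_, ?_⟩
    <;> intro p hp <;> simp only [Pi.sub_apply]
  · rw [hu h.smooth_z h'.smooth_z p hp, h.z_u p hp, h'.z_u p hp, smul_sub]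
  · rw [hv h.smooth_z h'.smooth_z p hp, h.z_v p hp, h'.z_v p hp, smul_sub]
  · rw [hu h.smooth_x h'.smooth_x p hp, h.x_u p hp, h'.x_u p hp]
    module
  · rw [hv h.smooth_x h'.smooth_x p hp, h.x_v p hp, h'.x_v p hp]
    module
  · rw [hu h.smooth_y h'.smooth_y p hp, h.y_u p hp, h'.y_u p hp]
    module
  · rw [hv h.smooth_y h'.smooth_y p hp, h.y_v p hp, h'.y_v p hp]
    module
  · rw [hu h.smooth_b h'.smooth_b p hp, h.b_u p hp, h'.b_u p hp]
    module
  · rw [hv h.smooth_b h'.smooth_b p hp, h.b_v p hp, h'.b_v p hp]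
    module
  · rw [hu h.smooth_l h'.smooth_l p hp, h.l_u p hp, h'.l_u p hp]
    module
  · rw [hv h.smooth_l h'.smooth_l p hp, h.l_v p hp, h'.l_v p hp]
    module

/-- The coefficients of the structure equations are skew-symmetric, hence the sum of the tensor
squares of the frame vectors is constant. -/
theorem sum_inner_mul_inner_eq (h : StructureEquations D phi A C n m k z x y b l) (hD : IsOpen D)
    (hc : IsPreconnected D) {p q : ℝ × ℝ} (hp : p ∈ D) (hq : q ∈ D) (w w' : E4) :
    inner ℝ (x p) w * inner ℝ (x p) w' + inner ℝ (y p) w * inner ℝ (y p) w' +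
      inner ℝ (b p) w * inner ℝ (b p) w' + inner ℝ (l p) w * inner ℝ (l p) w' =
    inner ℝ (x q) w * inner ℝ (x q) w' + inner ℝ (y q) w * inner ℝ (y q) w' +
      inner ℝ (b q) w * inner ℝ (b q) w' + inner ℝ (l q) w * inner ℝ (l q) w' := by
  have hi : ∀ {f : ℝ × ℝ → E4}, ContDiffOn ℝ ∞ f D → ∀ r ∈ D, ∀ w : E4,
      HasFDerivAt (fun q => inner ℝ (f q) w) ((innerSL ℝ w).comp (fderiv ℝ f r)) r := by
    intro f hf r hr w
    have := (innerSL ℝ w).hasFDerivAt.comp r (differentiableAt hD hf hr).hasFDerivAt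
    refine this.congr_of_eventuallyEq (Filter.Eventually.of_forall fun q => ?_)
    simp [real_inner_comm]
  have hm : ∀ {f : ℝ × ℝ → E4}, ContDiffOn ℝ ∞ f D → ∀ r ∈ D,
      HasFDerivAt (fun q => inner ℝ (f q) w * inner ℝ (f q) w')
        (inner ℝ (f r) w • (innerSL ℝ w').comp (fderiv ℝ f r) +
          inner ℝ (f r) w' • (innerSL ℝ w).comp (fderiv ℝ f r)) r :=
    fun hf r hr => (hi hf r hr w).mul (hi hf r hr w')
  have hder := fun r hr => (((hm h.smooth_x r hr).add (hm h.smooth_y r hr)).add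
    (hm h.smooth_b r hr)).add (hm h.smooth_l r hr)
  refine eq_of_partials_eq_zero hD hc
    (f := fun p => inner ℝ (x p) w * inner ℝ (x p) w' + inner ℝ (y p) w * inner ℝ (y p) w' +
      inner ℝ (b p) w * inner ℝ (b p) w' + inner ℝ (l p) w * inner ℝ (l p) w')
    (fun r hr => (hder r hr).differentiableAt.differentiableWithinAt) (fun r hr => ?_)
    (fun r hr => ?_) hp hq
  · refine (congrArg (fun T : ℝ × ℝ →L[ℝ] ℝ => T (1, 0)) (hder r hr).fderiv).trans ?_
    simp only [add_apply, smul_apply, ContinuousLinearMap.comp_apply, fderiv_u, h.x_u r hr,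
      h.y_u r hr, h.b_u r hr, h.l_u r hr, innerSL_apply_apply, inner_add_right, inner_smul_right,
      real_inner_comm w, real_inner_comm w', smul_eq_mul]
    ring
  · refine (congrArg (fun T : ℝ × ℝ →L[ℝ] ℝ => T (0, 1)) (hder r hr).fderiv).trans ?_
    simp only [add_apply, smul_apply, ContinuousLinearMap.comp_apply, fderiv_v, h.x_v r hr,
      h.y_v r hr, h.b_v r hr, h.l_v r hr, innerSL_apply_apply, inner_add_right, inner_smul_right,
      real_inner_comm w, real_inner_comm w', smul_eq_mul]
    ring

/-- Solutions of the structure equations are determined by their value at one point. -/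
theorem eqOn (h : StructureEquations D phi A C n m k z x y b l)
    (h' : StructureEquations D phi A C n m k z' x' y' b' l') (hD : IsOpen D)
    (hc : IsPreconnected D) {q : ℝ × ℝ} (hq : q ∈ D) (ez : z q = z' q) (ex : x q = x' q)
    (ey : y q = y' q) (eb : b q = b' q) (el : l q = l' q) : ∀ p ∈ D, z p = z' p := by
  have hs := h.sub h' hD
  have hF : ∀ p ∈ D, ∀ w, inner ℝ ((x - x') p) w = 0 ∧ inner ℝ ((y - y') p) w = 0 := by
    intro p hp w
    -- With equal test vectors the conserved quantity of the difference is a sum of four squares,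
    -- and it vanishes at `q`.
    have := hs.sum_inner_mul_inner_eq hD hc hp hq w w
    simp only [Pi.sub_apply, ex, ey, eb, el, sub_self, inner_zero_left, mul_zero, add_zero]
      at this ⊢
    constructor <;> nlinarith [mul_self_nonneg (inner ℝ (x p - x' p) w),
      mul_self_nonneg (inner ℝ (y p - y' p) w), mul_self_nonneg (inner ℝ (b p - b' p) w),
      mul_self_nonneg (inner ℝ (l p - l' p) w)]
  intro p hp
  refine sub_eq_zero.mp ((eq_of_partials_eq_zero hD hc (f := z - z')
    (hs.smooth_z.differentiableOn (by simp)) (fun r hr => ?_) (fun r hr => ?_) hp hq).trans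
      (sub_eq_zero.mpr ez))
  · rw [hs.z_u r hr, inner_self_eq_zero.mp (hF r hr _).1, smul_zero]
  · rw [hs.z_v r hr, inner_self_eq_zero.mp (hF r hr _).2, smul_zero]

end StructureEquations

/-- A family of as many vectors as the dimension which satisfies Parseval's identity is
orthonormal. -/
lemma orthonormal_of_sum_inner_mul_inner {ι : Type*} [Fintype ι]
    {f : ι → EuclideanSpace ℝ ι}
    (hf : ∀ w w', ∑ i, inner ℝ (f i) w * inner ℝ (f i) w' = inner ℝ w w') : Orthonormal ℝ f := by
  classical
  set M : Matrix ι ι ℝ := Matrix.of fun i k => f i k with hM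
  have h1 : M.transpose * M = 1 := by
    ext k k'
    have := hf (EuclideanSpace.single k 1) (EuclideanSpace.single k' 1)
    simpa [Matrix.mul_apply, hM, Matrix.one_apply, EuclideanSpace.inner_single_right,
      PiLp.single_apply, eq_comm] using this
  -- The rows of `M` are the vectors. Parseval on coordinate vectors gives `MᵀM = 1`; as `M` is
  -- square, the Gram matrix `MMᵀ` is the identity too.
  have h2 : M * M.transpose = 1 := mul_eq_one_comm.mp h1
  rw [orthonormal_iff_ite]
  intro i j
  have := congrFun (congrFun h2 j) i
  simpa [Matrix.mul_apply, hM, Matrix.one_apply, PiLp.inner_apply, eq_comm] using this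

lemma sum_inner_mul_inner_of_orthonormal {x y b l : E4} (h : Orthonormal ℝ ![x, y, b, l])
    (w w' : E4) : inner ℝ x w * inner ℝ x w' + inner ℝ y w * inner ℝ y w' +
      inner ℝ b w * inner ℝ b w' + inner ℝ l w * inner ℝ l w' = inner ℝ w w' := by
  let e := basisOfOrthonormalOfCardEqFinrank h (by simp)
  have he : ⇑e = ![x, y, b, l] := coe_basisOfOrthonormalOfCardEqFinrank h (by simp)
  have := (e.toOrthonormalBasis (by rwa [he])).sum_inner_mul_inner w w'
  simpa [Fin.sum_univ_four, he, real_inner_comm] using this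

/-- The conserved sum of tensor squares carries Parseval's identity from `q` to `p`, and four
vectors of `E4` satisfying it are orthonormal. -/
theorem StructureEquations.orthonormal {D : Set (ℝ × ℝ)} {phi A C n m k : ℝ × ℝ → ℝ}
    {z x y b l : ℝ × ℝ → E4} (h : StructureEquations D phi A C n m k z x y b l) (hD : IsOpen D)
    (hc : IsPreconnected D) {q : ℝ × ℝ} (hq : q ∈ D) (ho : Orthonormal ℝ ![x q, y q, b q, l q]) :
    ∀ p ∈ D, Orthonormal ℝ ![x p, y p, b p, l p] := by
  intro p hp
  refine orthonormal_of_sum_inner_mul_inner fun w w' => ?_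
  rw [Fin.sum_univ_four, ← sum_inner_mul_inner_of_orthonormal ho w w',
    ← h.sum_inner_mul_inner_eq hD hc hp hq w w']
  rfl

end StructureEquations

/-! ### Second fundamental form and normal connection in an adapted orthonormal frame. -/

section IsothermalFrame

open Set Metric Filter

lemma eq_sum_of_orthonormal {x y b l : E4} (h : Orthonormal ℝ ![x, y, b, l]) (w : E4) :
    w = inner ℝ w x • x + inner ℝ w y • y + inner ℝ w b • b + inner ℝ w l • l := by
  refine ext_inner_right ℝ fun w' => ?_
  rw [← sum_inner_mul_inner_of_orthonormal h w w']
  simp only [inner_add_left, inner_smul_left, RCLike.conj_to_real, real_inner_comm w]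

/-- `x`, `y`, `b`, `l` is an orthonormal frame field along `z` such that `z_u = phi x` and
`z_v = phi y`. -/
structure IsothermalFrame (D : Set (ℝ × ℝ)) (phi : ℝ × ℝ → ℝ) (z x y b l : ℝ × ℝ → E4) :
    Prop where
  isOpen : IsOpen D
  smooth_phi : ContDiffOn ℝ ∞ phi D
  pos : ∀ p ∈ D, 0 < phi p
  smooth_z : ContDiffOn ℝ ∞ z D
  smooth_x : ContDiffOn ℝ ∞ x D
  smooth_y : ContDiffOn ℝ ∞ y D
  smooth_b : ContDiffOn ℝ ∞ b D
  smooth_l : ContDiffOn ℝ ∞ l D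
  orthonormal : ∀ p ∈ D, Orthonormal ℝ ![x p, y p, b p, l p]
  z_u : ∀ p ∈ D, pu z p = phi p • x p
  z_v : ∀ p ∈ D, pv z p = phi p • y p

namespace IsothermalFrame

variable {D : Set (ℝ × ℝ)} {phi : ℝ × ℝ → ℝ} {z x y b l : ℝ × ℝ → E4} {p : ℝ × ℝ}

lemma differentiableAt {V : Type*} [NormedAddCommGroup V] [NormedSpace ℝ V]
    (h : IsothermalFrame D phi z x y b l) (hp : p ∈ D) {f : ℝ × ℝ → V}
    (hf : ContDiffOn ℝ ∞ f D) : DifferentiableAt ℝ f p :=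
  (hf.contDiffAt (h.isOpen.mem_nhds hp)).differentiableAt (by simp)

lemma ne_zero (h : IsothermalFrame D phi z x y b l) (hp : p ∈ D) : phi p ≠ 0 := (h.pos p hp).ne'

lemma inner_xx (h : IsothermalFrame D phi z x y b l) (hp : p ∈ D) : inner ℝ (x p) (x p) = 1 := by
  have := orthonormal_iff_ite.mp (h.orthonormal p hp) 0 0
  simpa using this

lemma inner_yy (h : IsothermalFrame D phi z x y b l) (hp : p ∈ D) : inner ℝ (y p) (y p) = 1 := by
  have := orthonormal_iff_ite.mp (h.orthonormal p hp) 1 1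
  simpa using this

lemma inner_bb (h : IsothermalFrame D phi z x y b l) (hp : p ∈ D) : inner ℝ (b p) (b p) = 1 := by
  have := orthonormal_iff_ite.mp (h.orthonormal p hp) 2 2
  simpa using this

lemma inner_ll (h : IsothermalFrame D phi z x y b l) (hp : p ∈ D) : inner ℝ (l p) (l p) = 1 := by
  have := orthonormal_iff_ite.mp (h.orthonormal p hp) 3 3
  simpa using this

lemma inner_xy (h : IsothermalFrame D phi z x y b l) (hp : p ∈ D) : inner ℝ (x p) (y p) = 0 := by
  have := orthonormal_iff_ite.mp (h.orthonormal p hp) 0 1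
  simpa using this

lemma inner_xb (h : IsothermalFrame D phi z x y b l) (hp : p ∈ D) : inner ℝ (x p) (b p) = 0 := by
  have := orthonormal_iff_ite.mp (h.orthonormal p hp) 0 2
  simpa using this

lemma inner_xl (h : IsothermalFrame D phi z x y b l) (hp : p ∈ D) : inner ℝ (x p) (l p) = 0 := by
  have := orthonormal_iff_ite.mp (h.orthonormal p hp) 0 3
  simpa using this

lemma inner_yb (h : IsothermalFrame D phi z x y b l) (hp : p ∈ D) : inner ℝ (y p) (b p) = 0 := by
  have := orthonormal_iff_ite.mp (h.orthonormal p hp) 1 2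
  simpa using this

lemma inner_yl (h : IsothermalFrame D phi z x y b l) (hp : p ∈ D) : inner ℝ (y p) (l p) = 0 := by
  have := orthonormal_iff_ite.mp (h.orthonormal p hp) 1 3
  simpa using this

lemma inner_bl (h : IsothermalFrame D phi z x y b l) (hp : p ∈ D) : inner ℝ (b p) (l p) = 0 := by
  have := orthonormal_iff_ite.mp (h.orthonormal p hp) 2 3
  simpa using this

lemma norm_b (h : IsothermalFrame D phi z x y b l) (hp : p ∈ D) : ‖b p‖ = 1 :=
  (h.orthonormal p hp).1 2

lemma norm_l (h : IsothermalFrame D phi z x y b l) (hp : p ∈ D) : ‖l p‖ = 1 :=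
  (h.orthonormal p hp).1 3

lemma coeffE_eq (h : IsothermalFrame D phi z x y b l) (hp : p ∈ D) : coeffE z p = phi p ^ 2 := by
  rw [coeffE, h.z_u p hp, inner_smul_left, inner_smul_right, h.inner_xx hp]
  simp [sq]

lemma coeffF_eq (h : IsothermalFrame D phi z x y b l) (hp : p ∈ D) : coeffF z p = 0 := by
  rw [coeffF, h.z_u p hp, h.z_v p hp, inner_smul_left, inner_smul_right, h.inner_xy hp]
  simp

lemma coeffG_eq (h : IsothermalFrame D phi z x y b l) (hp : p ∈ D) : coeffG z p = phi p ^ 2 := by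
  rw [coeffG, h.z_v p hp, inner_smul_left, inner_smul_right, h.inner_yy hp]
  simp [sq]

lemma unitU_eq (h : IsothermalFrame D phi z x y b l) (hp : p ∈ D) :
    unitU z p = ((phi p)⁻¹, 0) := by
  rw [unitU, h.coeffE_eq hp, Real.sqrt_sq (h.pos p hp).le]

lemma unitV_eq (h : IsothermalFrame D phi z x y b l) (hp : p ∈ D) :
    unitV z p = (0, (phi p)⁻¹) := by
  rw [unitV, h.coeffG_eq hp, Real.sqrt_sq (h.pos p hp).le]

lemma fderiv_unitU (h : IsothermalFrame D phi z x y b l) (hp : p ∈ D) (f : ℝ × ℝ → E4) :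
    fderiv ℝ f p (unitU z p) = (phi p)⁻¹ • pu f p := by
  rw [fderiv_apply_eq, h.unitU_eq hp]
  simp

lemma fderiv_unitV (h : IsothermalFrame D phi z x y b l) (hp : p ∈ D) (f : ℝ × ℝ → E4) :
    fderiv ℝ f p (unitV z p) = (phi p)⁻¹ • pv f p := by
  rw [fderiv_apply_eq, h.unitV_eq hp]
  simp

/-- Since `phi ≠ 0`, the vectors `x`, `y` lie in the tangent plane, so removing the `x` and `y`
components of `w` is the projection to the normal plane. -/
lemma normalPart_eq (h : IsothermalFrame D phi z x y b l) (hp : p ∈ D) (w : E4) :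
    normalPart z p w = inner ℝ w (b p) • b p + inner ℝ w (l p) • l p := by
  have hx : x p ∈ tangentPlane z p := by
    have : pu z p ∈ tangentPlane z p := Submodule.subset_span (by simp)
    rw [h.z_u p hp] at this
    exact (Submodule.smul_mem_iff _ (h.ne_zero hp)).mp this
  have hy : y p ∈ tangentPlane z p := by
    have : pv z p ∈ tangentPlane z p := Submodule.subset_span (by simp)
    rw [h.z_v p hp] at this
    exact (Submodule.smul_mem_iff _ (h.ne_zero hp)).mp this
  have hw := eq_sum_of_orthonormal (h.orthonormal p hp) w
  have hv : w - (inner ℝ w (x p) • x p + inner ℝ w (y p) • y p) =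
      inner ℝ w (b p) • b p + inner ℝ w (l p) • l p := by
    nth_rewrite 1 [hw]
    abel
  rw [normalPart, Submodule.starProjection_orthogonal_val,
    Submodule.eq_starProjection_of_mem_orthogonal
      (v := inner ℝ w (x p) • x p + inner ℝ w (y p) • y p)
      (Submodule.add_mem _ (Submodule.smul_mem _ _ hx) (Submodule.smul_mem _ _ hy)) ?_, hv]
  rw [hv, Submodule.mem_orthogonal]
  intro u hu
  rw [tangentPlane, h.z_u p hp, h.z_v p hp] at hu
  obtain ⟨s, t, rfl⟩ := Submodule.mem_span_pair.mp hu
  simp [inner_add_left, inner_add_right, inner_smul_left, inner_smul_right, h.inner_xb hp,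
    h.inner_xl hp, h.inner_yb hp, h.inner_yl hp]

lemma fderiv_of_eq_smul (h : IsothermalFrame D phi z x y b l) (hp : p ∈ D) {f w : ℝ × ℝ → E4}
    (hf : ContDiffOn ℝ ∞ f D) (hw : ∀ q ∈ D, w q = phi q • f q) (X : ℝ × ℝ) :
    fderiv ℝ w p X = phi p • fderiv ℝ f p X + fderiv ℝ phi p X • f p := by
  have : w =ᶠ[nhds p] fun q => phi q • f q := by
    filter_upwards [h.isOpen.mem_nhds hp] with q hq using hw q hq
  rw [this.fderiv_eq, fderiv_smul_eq (h.differentiableAt hp h.smooth_phi)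
    (h.differentiableAt hp hf)]

lemma secondForm_uu (h : IsothermalFrame D phi z x y b l) (hp : p ∈ D) :
    secondForm z p (1, 0) (1, 0) =
      phi p • (inner ℝ (pu x p) (b p) • b p + inner ℝ (pu x p) (l p) • l p) := by
  rw [secondForm, flatDeriv, h.normalPart_eq hp,
    h.fderiv_of_eq_smul hp h.smooth_x (w := fun q => fderiv ℝ z q (1, 0)) h.z_u, fderiv_u]
  simp [inner_add_left, inner_smul_left, h.inner_xb hp, h.inner_xl hp, smul_smul]

lemma secondForm_vv (h : IsothermalFrame D phi z x y b l) (hp : p ∈ D) :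
    secondForm z p (0, 1) (0, 1) =
      phi p • (inner ℝ (pv y p) (b p) • b p + inner ℝ (pv y p) (l p) • l p) := by
  rw [secondForm, flatDeriv, h.normalPart_eq hp,
    h.fderiv_of_eq_smul hp h.smooth_y (w := fun q => fderiv ℝ z q (0, 1)) h.z_v, fderiv_v]
  simp [inner_add_left, inner_smul_left, h.inner_yb hp, h.inner_yl hp, smul_smul]

lemma secondForm_smul_smul (h : IsothermalFrame D phi z x y b l) (hp : p ∈ D) (s t : ℝ)
    (X Y : ℝ × ℝ) : secondForm z p (s • X) (t • Y) = (s * t) • secondForm z p X Y := by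
  have h1 : (fun q => fderiv ℝ z q (t • Y)) = t • fun q => fderiv ℝ z q Y := by
    funext q
    simp
  have h2 : DifferentiableAt ℝ (fun q => fderiv ℝ z q Y) p :=
    ((((h.smooth_z.contDiffAt (h.isOpen.mem_nhds hp)).fderiv_right (m := 1) (by
      rw [one_add_one_eq_two]
      exact WithTop.coe_le_coe.mpr (le_top : (2 : ℕ∞) ≤ ⊤))).differentiableAt
        (by simp)).clm_apply (differentiableAt_const Y))
  rw [secondForm, flatDeriv, h1, fderiv_const_smul h2, secondForm, flatDeriv, normalPart,
    normalPart, ← map_smul]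
  simp [smul_smul]

lemma secondForm_unitU (h : IsothermalFrame D phi z x y b l) (hp : p ∈ D) :
    secondForm z p (unitU z p) (unitU z p) =
      (phi p)⁻¹ • (inner ℝ (pu x p) (b p) • b p + inner ℝ (pu x p) (l p) • l p) := by
  have : unitU z p = (phi p)⁻¹ • ((1, 0) : ℝ × ℝ) := by simp [h.unitU_eq hp]
  rw [this, h.secondForm_smul_smul hp, h.secondForm_uu hp, smul_smul]
  congr 1
  field_simp [h.ne_zero hp]

lemma secondForm_unitV (h : IsothermalFrame D phi z x y b l) (hp : p ∈ D) :
    secondForm z p (unitV z p) (unitV z p) =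
      (phi p)⁻¹ • (inner ℝ (pv y p) (b p) • b p + inner ℝ (pv y p) (l p) • l p) := by
  have : unitV z p = (phi p)⁻¹ • ((0, 1) : ℝ × ℝ) := by simp [h.unitV_eq hp]
  rw [this, h.secondForm_smul_smul hp, h.secondForm_vv hp, smul_smul]
  congr 1
  field_simp [h.ne_zero hp]

lemma meanCurvature_eq (h : IsothermalFrame D phi z x y b l) (hp : p ∈ D) :
    meanCurvature z p = (2 * phi p)⁻¹ •
      ((inner ℝ (pu x p) (b p) + inner ℝ (pv y p) (b p)) • b p +
        (inner ℝ (pu x p) (l p) + inner ℝ (pv y p) (l p)) • l p) := by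
  have := h.ne_zero hp
  rw [meanCurvature, h.coeffE_eq hp, h.coeffF_eq hp, h.coeffG_eq hp, h.secondForm_uu hp,
    h.secondForm_vv hp]
  match_scalars <;> field_simp <;> ring

/-- If the mean curvature vector is `nu b`, the derivative of its normalization in the normal
bundle is, up to sign, that of `b`. -/
lemma normalDeriv_normalized (h : IsothermalFrame D phi z x y b l) {nu : ℝ × ℝ → ℝ}
    (hnu : ContinuousOn nu D) (hnu0 : ∀ q ∈ D, nu q ≠ 0)
    (hH : ∀ q ∈ D, meanCurvature z q = nu q • b q) (hp : p ∈ D) (X : ℝ × ℝ) :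
    normalDeriv z (fun q => ‖meanCurvature z q‖⁻¹ • meanCurvature z q) p X =
      (|nu p|⁻¹ * nu p) • (inner ℝ (fderiv ℝ b p X) (b p) • b p +
        inner ℝ (fderiv ℝ b p X) (l p) • l p) := by
  have hD := h.isOpen.mem_nhds hp
  -- The sign of a continuous nonvanishing function is locally constant, so it passes through the
  -- derivative.
  have hsign : ∀ᶠ q in nhds p, |nu q|⁻¹ * nu q = |nu p|⁻¹ * nu p := by
    have hc := hnu.continuousAt hD
    rcases (hnu0 p hp).lt_or_gt with hneg | hpos
    · filter_upwards [hc.eventually (gt_mem_nhds hneg)] with q hq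
      have hq : nu q < 0 := hq
      rw [abs_of_neg hq, abs_of_neg hneg, inv_neg, inv_neg, neg_mul, neg_mul,
        inv_mul_cancel₀ hq.ne, inv_mul_cancel₀ hneg.ne]
    · filter_upwards [hc.eventually (lt_mem_nhds hpos)] with q hq
      have hq : 0 < nu q := hq
      rw [abs_of_pos hq, abs_of_pos hpos, inv_mul_cancel₀ hq.ne', inv_mul_cancel₀ hpos.ne']
  have heq : (fun q => ‖meanCurvature z q‖⁻¹ • meanCurvature z q) =ᶠ[nhds p]
      (|nu p|⁻¹ * nu p) • b := by
    filter_upwards [hD, hsign] with q hq hs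
    rw [hH q hq, norm_smul, h.norm_b hq, mul_one, Real.norm_eq_abs, smul_smul, hs]
    rfl
  rw [normalDeriv, flatDeriv, heq.fderiv_eq,
    fderiv_const_smul (h.differentiableAt hp h.smooth_b), h.normalPart_eq hp]
  simp [inner_smul_left, smul_smul]

/-- Derivatives of two fields with constant inner product. -/
lemma inner_fderiv_of_const (h : IsothermalFrame D phi z x y b l) {f f' : ℝ × ℝ → E4}
    (hf : ContDiffOn ℝ ∞ f D) (hf' : ContDiffOn ℝ ∞ f' D) {c : ℝ}
    (hc : ∀ q ∈ D, inner ℝ (f q) (f' q) = c) (hp : p ∈ D) (X : ℝ × ℝ) :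
    inner ℝ (fderiv ℝ f p X) (f' p) = -inner ℝ (fderiv ℝ f' p X) (f p) := by
  have heq : (fun q => inner ℝ (f q) (f' q)) =ᶠ[nhds p] fun _ => c := by
    filter_upwards [h.isOpen.mem_nhds hp] with q hq using hc q hq
  have := fderiv_inner_eq (h.differentiableAt hp hf) (h.differentiableAt hp hf') X
  rw [heq.fderiv_eq, fderiv_fun_const] at this
  rw [real_inner_comm (f p) (fderiv ℝ f' p X)]
  simp only [Pi.zero_apply, zero_apply] at this
  linarith

/-- This is `z_uv = z_vu` written in the frame. It ties `x_v` to `y_u` and thereby determines the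
tangential connection. -/
lemma symmetry (h : IsothermalFrame D phi z x y b l) (hp : p ∈ D) :
    phi p • pv x p + pv phi p • x p = phi p • pu y p + pu phi p • y p := by
  have hs : IsSymmSndFDerivAt ℝ z p :=
    (h.smooth_z.contDiffAt (h.isOpen.mem_nhds hp)).isSymmSndFDerivAt (by
      rw [minSmoothness_of_isRCLikeNormedField]
      exact WithTop.coe_le_coe.mpr (le_top : (2 : ℕ∞) ≤ ⊤))
  have hd : DifferentiableAt ℝ (fderiv ℝ z) p :=
    ((h.smooth_z.contDiffAt (h.isOpen.mem_nhds hp)).fderiv_right (m := 1) (by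
      rw [one_add_one_eq_two]
      exact WithTop.coe_le_coe.mpr (le_top : (2 : ℕ∞) ≤ ⊤))).differentiableAt (by simp)
  have hX : ∀ X Y, fderiv ℝ (fun q => fderiv ℝ z q X) p Y = fderiv ℝ (fderiv ℝ z) p Y X := by
    intro X Y
    rw [fderiv_clm_apply hd (differentiableAt_const X)]
    simp
  have h1 := h.fderiv_of_eq_smul hp h.smooth_x (w := fun q => fderiv ℝ z q (1, 0)) h.z_u (0, 1)
  have h2 := h.fderiv_of_eq_smul hp h.smooth_y (w := fun q => fderiv ℝ z q (0, 1)) h.z_v (1, 0)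
  rw [hX] at h1 h2
  rw [hs.eq, h2] at h1
  exact h1.symm

end IsothermalFrame

end IsothermalFrame

/-! ### Calculus of `ln|μ|` and of the conformal factor `|μ|^(-1/2)`. -/

section Conformal

variable {D : Set (ℝ × ℝ)} {mu : ℝ × ℝ → ℝ} {p : ℝ × ℝ}

/-- The function `ln |mu|`. -/
def logAbs (mu : ℝ × ℝ → ℝ) (p : ℝ × ℝ) : ℝ := Real.log |mu p|

/-- The conformal factor `1 / √|mu|` of canonical parameters. -/
def conformalFactor (mu : ℝ × ℝ → ℝ) (p : ℝ × ℝ) : ℝ := Real.exp (-(logAbs mu p / 2))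

lemma conformalFactor_pos (mu : ℝ × ℝ → ℝ) (p : ℝ × ℝ) : 0 < conformalFactor mu p :=
  Real.exp_pos _

lemma conformalFactor_sq (h : mu p ≠ 0) : conformalFactor mu p ^ 2 = 1 / |mu p| := by
  rw [conformalFactor, ← Real.exp_nat_mul, logAbs, one_div,
    show ((2 : ℕ) : ℝ) * -(Real.log |mu p| / 2) = -Real.log |mu p| by push_cast; ring,
    Real.exp_neg, Real.exp_log (abs_pos.mpr h)]

/-- `Real.log` is even by convention, so the absolute value, which would obstruct differentiation,
disappears. -/
lemma logAbs_eq (mu : ℝ × ℝ → ℝ) : logAbs mu = fun p => Real.log (mu p) := by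
  funext p
  rw [logAbs, Real.log_abs]

lemma contDiffOn_logAbs (hmu : ContDiffOn ℝ ∞ mu D) (h0 : ∀ p ∈ D, mu p ≠ 0) :
    ContDiffOn ℝ ∞ (logAbs mu) D := by
  rw [logAbs_eq]
  exact hmu.log h0

lemma contDiffOn_conformalFactor (hmu : ContDiffOn ℝ ∞ mu D) (h0 : ∀ p ∈ D, mu p ≠ 0) :
    ContDiffOn ℝ ∞ (conformalFactor mu) D :=
  ((contDiffOn_logAbs hmu h0).div_const 2).neg.exp

lemma contDiffOn_fderiv_apply {V : Type*} [NormedAddCommGroup V] [NormedSpace ℝ V]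
    (hD : IsOpen D) {f : ℝ × ℝ → V} (hf : ContDiffOn ℝ ∞ f D) (X : ℝ × ℝ) :
    ContDiffOn ℝ ∞ (fun p => fderiv ℝ f p X) D :=
  (hf.fderiv_of_isOpen hD (by simp)).clm_apply contDiffOn_const

lemma fderiv_conformalFactor (hd : DifferentiableAt ℝ (logAbs mu) p) (X : ℝ × ℝ) :
    fderiv ℝ (conformalFactor mu) p X = -(fderiv ℝ (logAbs mu) p X / 2) * conformalFactor mu p := by
  have : HasFDerivAt (conformalFactor mu)
      (conformalFactor mu p • -((2 : ℝ)⁻¹ • fderiv ℝ (logAbs mu) p)) p := by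
    have := ((hd.hasFDerivAt.const_smul (2 : ℝ)⁻¹).neg).exp
    refine (this.congr_of_eventuallyEq (Filter.Eventually.of_forall fun q => ?_)).congr_fderiv ?_
    · simp [conformalFactor, div_eq_inv_mul]
    · simp [conformalFactor, div_eq_inv_mul]
  rw [this.fderiv]
  simp
  ring

lemma fderiv_eq_mul_fderiv_logAbs (hd : DifferentiableAt ℝ mu p) (h0 : mu p ≠ 0) (X : ℝ × ℝ) :
    fderiv ℝ mu p X = mu p * fderiv ℝ (logAbs mu) p X := by
  rw [logAbs_eq, fderiv.log hd h0]
  simp [h0]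

lemma fderiv_conformalFactor_mul (hd : DifferentiableAt ℝ (logAbs mu) p) {f : ℝ × ℝ → ℝ}
    (hf : DifferentiableAt ℝ f p) (X : ℝ × ℝ) :
    fderiv ℝ (fun q => conformalFactor mu q * f q) p X = conformalFactor mu p *
      (fderiv ℝ f p X - fderiv ℝ (logAbs mu) p X / 2 * f p) := by
  have hc : DifferentiableAt ℝ (conformalFactor mu) p := by
    unfold conformalFactor
    fun_prop
  rw [fderiv_fun_mul hc hf]
  simp only [add_apply, smul_apply, smul_eq_mul, fderiv_conformalFactor hd]
  ring

end Conformal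

/-! ### Equivalence of realizations with orthonormal solutions of the canonical equations. -/

section Realization

open Set Metric

variable {D : Set (ℝ × ℝ)} {lam mu nu : ℝ × ℝ → ℝ} {z x y b l : ℝ × ℝ → E4}

/-- The structure equations of a surface in canonical parameters with geometric functions `lam`,
`mu`, `nu`. -/
abbrev CanonicalEquations (D : Set (ℝ × ℝ)) (lam mu nu : ℝ × ℝ → ℝ) (z x y b l : ℝ × ℝ → E4) :
    Prop :=
  StructureEquations D (conformalFactor mu) (fun p => pu (logAbs mu) p / 2)
    (fun p => pv (logAbs mu) p / 2) (fun p => conformalFactor mu p * nu p)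
    (fun p => conformalFactor mu p * lam p) (fun p => conformalFactor mu p * mu p) z x y b l

/-- With `φ² = 1/|μ|` the Codazzi equations involving `b` become `h1` and `h2` and the Gauss
equation becomes `h3`; those for `φ` and `φμ` hold automatically. -/
theorem exists_canonicalEquations (hD : IsOpen D) (hlam : ContDiffOn ℝ ∞ lam D)
    (hmu : ContDiffOn ℝ ∞ mu D) (hnu : ContDiffOn ℝ ∞ nu D) (hmu0 : ∀ p ∈ D, mu p ≠ 0)
    (h1 : ∀ p ∈ D, pu nu p = pv lam p - lam p * pv (logAbs mu) p)
    (h2 : ∀ p ∈ D, pv nu p = pu lam p - lam p * pu (logAbs mu) p)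
    (h3 : ∀ p ∈ D, nu p ^ 2 - (lam p ^ 2 + mu p ^ 2) =
      1 / 2 * |mu p| * laplace (logAbs mu) p)
    {q : ℝ × ℝ} (hq : q ∈ D) (z₀ x₀ y₀ b₀ l₀ : E4) :
    ∃ ε > 0, ball q ε ⊆ D ∧ ∃ z x y b l : ℝ × ℝ → E4,
      CanonicalEquations (ball q ε) lam mu nu z x y b l ∧
      z q = z₀ ∧ x q = x₀ ∧ y q = y₀ ∧ b q = b₀ ∧ l q = l₀ := by
  have hd : ∀ {f : ℝ × ℝ → ℝ}, ContDiffOn ℝ ∞ f D → ∀ p ∈ D, DifferentiableAt ℝ f p :=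
    fun hf p hp => (hf.contDiffAt (hD.mem_nhds hp)).differentiableAt (by simp)
  have hg := contDiffOn_logAbs hmu hmu0
  have hphi := contDiffOn_conformalFactor hmu hmu0
  have hgu : ContDiffOn ℝ ∞ (pu (logAbs mu)) D := contDiffOn_fderiv_apply hD hg (1, 0)
  have hgv : ContDiffOn ℝ ∞ (pv (logAbs mu)) D := contDiffOn_fderiv_apply hD hg (0, 1)
  refine exists_structureEquations hD hphi (hgu.div_const 2) (hgv.div_const 2) (hphi.mul hnu)
    (hphi.mul hlam) (hphi.mul hmu) (fun p hp => ?_) (fun p hp => ?_) (fun p hp => ?_)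
    (fun p hp => ?_) (fun p hp => ?_) (fun p hp => ?_) (fun p hp => ?_) hq z₀ x₀ y₀ b₀ l₀
  · exact fderiv_conformalFactor (hd hg p hp) _
  · exact fderiv_conformalFactor (hd hg p hp) _
  · have := fderiv_eq_mul_fderiv_logAbs (hd hmu p hp) (hmu0 p hp) (1, 0)
    rw [pu, fderiv_conformalFactor_mul (hd hg p hp) (hd hmu p hp), this, fderiv_u]
    ring
  · have := fderiv_eq_mul_fderiv_logAbs (hd hmu p hp) (hmu0 p hp) (0, 1)
    rw [pv, fderiv_conformalFactor_mul (hd hg p hp) (hd hmu p hp), this, fderiv_v]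
    ring
  · rw [pu, pv, fderiv_conformalFactor_mul (hd hg p hp) (hd hnu p hp),
      fderiv_conformalFactor_mul (hd hg p hp) (hd hlam p hp), fderiv_u, fderiv_u, fderiv_v,
      fderiv_v, h1 p hp]
    ring
  · rw [pu, pv, fderiv_conformalFactor_mul (hd hg p hp) (hd hnu p hp),
      fderiv_conformalFactor_mul (hd hg p hp) (hd hlam p hp), fderiv_u, fderiv_u, fderiv_v,
      fderiv_v, h2 p hp]
    ring
  · have e1 : pu (fun p => pu (logAbs mu) p / 2) p = pu (pu (logAbs mu)) p / 2 := by
      simp only [div_eq_inv_mul]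
      rw [pu, fderiv_const_mul (hd hgu p hp)]
      rfl
    have e2 : pv (fun p => pv (logAbs mu) p / 2) p = pv (pv (logAbs mu)) p / 2 := by
      simp only [div_eq_inv_mul]
      rw [pv, fderiv_const_mul (hd hgv p hp)]
      rfl
    have e3 := h3 p hp
    have e4 : |mu p| ≠ 0 := abs_ne_zero.mpr (hmu0 p hp)
    rw [laplace] at e3
    rw [e1, e2]
    simp only [mul_pow, conformalFactor_sq (hmu0 p hp)]
    field_simp
    linarith

theorem CanonicalEquations.isothermalFrame (h : CanonicalEquations D lam mu nu z x y b l)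
    (hD : IsOpen D) (hmu : ContDiffOn ℝ ∞ mu D) (hmu0 : ∀ p ∈ D, mu p ≠ 0)
    (ho : ∀ p ∈ D, Orthonormal ℝ ![x p, y p, b p, l p]) :
    IsothermalFrame D (conformalFactor mu) z x y b l :=
  ⟨hD, contDiffOn_conformalFactor hmu hmu0, fun p _ => conformalFactor_pos mu p, h.smooth_z,
    h.smooth_x, h.smooth_y, h.smooth_b, h.smooth_l, ho, h.z_u, h.z_v⟩

theorem CanonicalEquations.isRealization (h : CanonicalEquations D lam mu nu z x y b l)
    (hf : IsothermalFrame D (conformalFactor mu) z x y b l) (hnu : ContDiffOn ℝ ∞ nu D)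
    (hmu0 : ∀ p ∈ D, mu p ≠ 0) (hnu0 : ∀ p ∈ D, nu p ≠ 0) (q : ℝ × ℝ) :
    IsRealization D lam mu nu q (z q) (x q) (y q) (b q) (l q) z := by
  have i1 : ∀ p ∈ D, inner ℝ (pu x p) (b p) = conformalFactor mu p * nu p := fun p hp => by
    rw [h.x_u p hp]
    simp [inner_add_left, inner_smul_left, hf.inner_yb hp, hf.norm_b hp]
  have i2 : ∀ p ∈ D, inner ℝ (pv y p) (b p) = conformalFactor mu p * nu p := fun p hp => by
    rw [h.y_v p hp]
    simp [inner_add_left, inner_smul_left, hf.inner_xb hp, hf.norm_b hp]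
  have i3 : ∀ p ∈ D, inner ℝ (pu x p) (l p) = 0 := fun p hp => by
    rw [h.x_u p hp]
    simp [inner_add_left, inner_smul_left, hf.inner_yl hp, hf.inner_bl hp]
  have i4 : ∀ p ∈ D, inner ℝ (pv y p) (l p) = 0 := fun p hp => by
    rw [h.y_v p hp]
    simp [inner_add_left, inner_smul_left, hf.inner_xl hp, hf.inner_bl hp]
  have i5 : ∀ p ∈ D, inner ℝ (pu y p) (b p) = conformalFactor mu p * lam p := fun p hp => by
    rw [h.y_u p hp]
    simp [inner_add_left, inner_smul_left, hf.inner_xb hp, hf.norm_b hp,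
      real_inner_comm (b p) (l p), hf.inner_bl hp]
  have i6 : ∀ p ∈ D, inner ℝ (pu y p) (l p) = conformalFactor mu p * mu p := fun p hp => by
    rw [h.y_u p hp]
    simp [inner_add_left, inner_smul_left, hf.inner_xl hp, hf.norm_l hp, hf.inner_bl hp]
  have hH : ∀ p ∈ D, meanCurvature z p = nu p • b p := fun p hp => by
    have := hf.ne_zero hp
    rw [hf.meanCurvature_eq hp, i1 p hp, i2 p hp, i3 p hp, i4 p hp]
    match_scalars <;> field_simp <;> ring
  have hb : ∀ p ∈ D, b p ≠ 0 := fun p hp => (hf.orthonormal p hp).ne_zero 2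
  refine ⟨⟨h.smooth_z, fun p hp => ?_⟩, ⟨fun p hp => ?_, fun p hp X => ?_⟩, rfl,
    ⟨x, y, b, l, ⟨h.smooth_b, h.smooth_l, hf.orthonormal, fun p hp => ?_, fun p hp => ?_,
      fun p hp => ?_, fun p hp => ⟨nu p, hH p hp⟩⟩, rfl, rfl, rfl, rfl,
      ⟨fun p hp => ?_, fun p hp => ?_, fun p hp => ?_, fun p hp => ?_⟩⟩,
    ⟨fun p hp => ?_, fun p hp => hf.coeffF_eq hp, fun p hp => ?_⟩⟩
  · rw [LinearIndependent.pair_iff]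
    intro s t hst
    have hphi := hf.ne_zero hp
    rw [h.z_u p hp, h.z_v p hp] at hst
    have e1 := congrArg (fun w => inner ℝ w (x p)) hst
    have e2 := congrArg (fun w => inner ℝ w (y p)) hst
    simp only [inner_add_left, inner_smul_left, hf.inner_xx hp, hf.inner_yy hp, hf.inner_xy hp,
      real_inner_comm (x p) (y p), inner_zero_left, RCLike.conj_to_real] at e1 e2
    constructor
    · simpa [hphi] using e1
    · simpa [hphi] using e2
  · rw [hH p hp]
    exact smul_ne_zero (hnu0 p hp) (hb p hp)
  · have e1 : inner ℝ (fderiv ℝ b p X) (b p) = 0 := by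
      rw [fderiv_apply_eq, h.b_u p hp, h.b_v p hp]
      simp [inner_add_left, inner_smul_left, hf.inner_xb hp, hf.inner_yb hp]
    have e2 : inner ℝ (fderiv ℝ b p X) (l p) = 0 := by
      rw [fderiv_apply_eq, h.b_u p hp, h.b_v p hp]
      simp [inner_add_left, inner_smul_left, hf.inner_xl hp, hf.inner_yl hp]
    rw [hf.normalDeriv_normalized hnu.continuousOn hnu0 hH hp, e1, e2]
    simp
  · rw [hf.fderiv_unitU hp, h.z_u p hp, inv_smul_smul₀ (hf.ne_zero hp)]
  · rw [hf.fderiv_unitV hp, h.z_v p hp, inv_smul_smul₀ (hf.ne_zero hp)]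
  · rw [hf.secondForm_unitU hp, hf.secondForm_unitV hp, i1 p hp, i2 p hp, i3 p hp, i4 p hp,
      LinearIndependent.pair_iff]
    intro hli
    -- Both `σ(x,x)` and `σ(y,y)` equal `νb`, so their difference is a nontrivial relation.
    simpa using (hli 1 (-1) (by module)).1
  · rw [flatDeriv, hf.fderiv_unitU hp, inner_smul_left, i1 p hp]
    exact inv_mul_cancel_left₀ (hf.ne_zero hp) _
  · rw [flatDeriv, hf.fderiv_unitV hp, inner_smul_left, i2 p hp]
    exact inv_mul_cancel_left₀ (hf.ne_zero hp) _
  · rw [flatDeriv, hf.fderiv_unitU hp, inner_smul_left, i5 p hp]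
    exact inv_mul_cancel_left₀ (hf.ne_zero hp) _
  · rw [flatDeriv, hf.fderiv_unitU hp, inner_smul_left, i6 p hp]
    exact inv_mul_cancel_left₀ (hf.ne_zero hp) _
  · rw [hf.coeffE_eq hp, conformalFactor_sq (hmu0 p hp)]
  · rw [hf.coeffG_eq hp, conformalFactor_sq (hmu0 p hp)]

/-- All frame coefficients are recovered: the `b` and `l` components from the geometric functions,
collinearity and principality, the normal connection from parallelism of `H/‖H‖`, the tangential one
from `symmetry`, and the remaining ones from orthonormality. -/
theorem exists_canonicalEquations_of_isRealization {q : ℝ × ℝ} {p₀ x₀ y₀ b₀ l₀ : E4}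
    (hD : IsOpen D) (hmu : ContDiffOn ℝ ∞ mu D) (hnu : ContDiffOn ℝ ∞ nu D)
    (hmu0 : ∀ p ∈ D, mu p ≠ 0) (hnu0 : ∀ p ∈ D, nu p ≠ 0)
    (h : IsRealization D lam mu nu q p₀ x₀ y₀ b₀ l₀ z) :
    z q = p₀ ∧ ∃ x y b l : ℝ × ℝ → E4, CanonicalEquations D lam mu nu z x y b l ∧
      x q = x₀ ∧ y q = y₀ ∧ b q = b₀ ∧ l q = l₀ := by
  obtain ⟨hz, hpar, hz0, ⟨x, y, b, l, hfr, hx0, hy0, hb0, hl0, hgf⟩, hcan⟩ := h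
  refine ⟨hz0, x, y, b, l, ?_, hx0, hy0, hb0, hl0⟩
  have hphi := contDiffOn_conformalFactor hmu hmu0
  have hpos := conformalFactor_pos mu
  have hEs : ∀ p ∈ D, √(coeffE z p) = conformalFactor mu p := fun p hp => by
    rw [hcan.E_eq p hp, ← conformalFactor_sq (hmu0 p hp), Real.sqrt_sq (hpos p).le]
  have hGs : ∀ p ∈ D, √(coeffG z p) = conformalFactor mu p := fun p hp => by
    rw [hcan.G_eq p hp, ← conformalFactor_sq (hmu0 p hp), Real.sqrt_sq (hpos p).le]
  have hx : ∀ p ∈ D, x p = (conformalFactor mu p)⁻¹ • pu z p := fun p hp => by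
    rw [hfr.x_eq p hp, fderiv_apply_eq, unitU, hEs p hp]
    simp
  have hy : ∀ p ∈ D, y p = (conformalFactor mu p)⁻¹ • pv z p := fun p hp => by
    rw [hfr.y_eq p hp, fderiv_apply_eq, unitV, hGs p hp]
    simp
  have hinv : ContDiffOn ℝ ∞ (fun p => (conformalFactor mu p)⁻¹) D :=
    hphi.inv fun p _ => (hpos p).ne'
  have hf : IsothermalFrame D (conformalFactor mu) z x y b l :=
    ⟨hD, hphi, fun p _ => hpos p, hz.smooth,
      (hinv.smul (contDiffOn_fderiv_apply hD hz.smooth (1, 0))).congr hx,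
      (hinv.smul (contDiffOn_fderiv_apply hD hz.smooth (0, 1))).congr hy,
      hfr.smooth_b, hfr.smooth_l, hfr.orthonormal,
      fun p hp => by rw [hx p hp, smul_inv_smul₀ (hpos p).ne'],
      fun p hp => by rw [hy p hp, smul_inv_smul₀ (hpos p).ne']⟩
  have hmul : ∀ {p : ℝ × ℝ} {w w' : E4} {c : ℝ},
      inner ℝ ((conformalFactor mu p)⁻¹ • w) w' = c → inner ℝ w w' = conformalFactor mu p * c := by
    intro p w w' c h
    rw [inner_smul_left, RCLike.conj_to_real] at h
    rw [← h, mul_inv_cancel_left₀ (hpos p).ne']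
  have i1 : ∀ p ∈ D, inner ℝ (pu x p) (b p) = conformalFactor mu p * nu p := fun p hp =>
    hmul (by rw [← hgf.nu_one p hp, flatDeriv, hf.fderiv_unitU hp])
  have i2 : ∀ p ∈ D, inner ℝ (pv y p) (b p) = conformalFactor mu p * nu p := fun p hp =>
    hmul (by rw [← hgf.nu_two p hp, flatDeriv, hf.fderiv_unitV hp])
  have i3 : ∀ p ∈ D, inner ℝ (pu y p) (b p) = conformalFactor mu p * lam p := fun p hp =>
    hmul (by rw [← hgf.lam_eq p hp, flatDeriv, hf.fderiv_unitU hp])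
  have i4 : ∀ p ∈ D, inner ℝ (pu y p) (l p) = conformalFactor mu p * mu p := fun p hp =>
    hmul (by rw [← hgf.mu_eq p hp, flatDeriv, hf.fderiv_unitU hp])
  -- As `H` is a multiple of `b`, the trace of the `l` component of `σ` vanishes.
  have i5 : ∀ p ∈ D, inner ℝ (pu x p) (l p) + inner ℝ (pv y p) (l p) = 0 := fun p hp => by
    obtain ⟨c, hc⟩ := hfr.collinear p hp
    rw [hf.meanCurvature_eq hp] at hc
    have e := congrArg (fun w => inner ℝ w (l p)) hc
    simpa [inner_add_left, inner_smul_left, hf.inner_bl hp, hf.norm_l hp, hf.ne_zero hp] using e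
  have hH : ∀ p ∈ D, meanCurvature z p = nu p • b p := fun p hp => by
    have := hf.ne_zero hp
    rw [hf.meanCurvature_eq hp, i1 p hp, i2 p hp, i5 p hp]
    match_scalars <;> field_simp <;> ring
  -- Now `σ(x,x) = νb + αl` and `σ(y,y) = νb - αl`. For `ν ≠ 0` and `α ≠ 0` these are independent,
  -- contrary to the directions being principal.
  have i6 : ∀ p ∈ D, inner ℝ (pu x p) (l p) = 0 := fun p hp => by
    by_contra hne
    refine hfr.principal p hp (LinearIndependent.pair_iff.mpr fun s t hst => ?_)
    have hphi0 := hf.ne_zero hp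
    rw [hf.secondForm_unitU hp, hf.secondForm_unitV hp, i1 p hp, i2 p hp,
      show inner ℝ (pv y p) (l p) = -inner ℝ (pu x p) (l p) by linarith [i5 p hp]] at hst
    have e1 := congrArg (fun w => inner ℝ w (b p)) hst
    have e2 := congrArg (fun w => inner ℝ w (l p)) hst
    simp only [inner_add_left, inner_smul_left, hf.inner_bb hp, hf.inner_ll hp, hf.inner_bl hp,
      real_inner_comm (b p) (l p), inner_zero_left, RCLike.conj_to_real, mul_zero, mul_one,
      add_zero, zero_add] at e1 e2
    have e3 : (s + t) * nu p = 0 := by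
      field_simp at e1
      linarith
    have e4 : (s - t) * inner ℝ (pu x p) (l p) = 0 := by
      field_simp at e2
      linarith
    have e5 := (mul_eq_zero.mp e3).resolve_right (hnu0 p hp)
    have e6 := (mul_eq_zero.mp e4).resolve_right hne
    constructor <;> linarith
  have i7 : ∀ p ∈ D, inner ℝ (pv y p) (l p) = 0 := fun p hp => by
    linarith [i5 p hp, i6 p hp]
  have i8 : ∀ p ∈ D, ∀ X, inner ℝ (fderiv ℝ b p X) (l p) = 0 := fun p hp X => by
    have e := hpar.parallel p hp X
    rw [hf.normalDeriv_normalized hnu.continuousOn hnu0 hH hp] at e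
    have e1 := (smul_eq_zero.mp e).resolve_left
      (mul_ne_zero (inv_ne_zero (abs_ne_zero.mpr (hnu0 p hp))) (hnu0 p hp))
    simpa [inner_add_left, inner_smul_left, hf.inner_bl hp, hf.norm_l hp] using
      congrArg (fun w => inner ℝ w (l p)) e1
  have hself : ∀ {f : ℝ × ℝ → E4}, ContDiffOn ℝ ∞ f D → (∀ p ∈ D, inner ℝ (f p) (f p) = 1) →
      ∀ p ∈ D, ∀ X, inner ℝ (fderiv ℝ f p X) (f p) = 0 := fun hsf h1 p hp X => by
    linarith [hf.inner_fderiv_of_const hsf hsf h1 hp X]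
  have jxx := hself hf.smooth_x fun p hp => hf.inner_xx hp
  have jyy := hself hf.smooth_y fun p hp => hf.inner_yy hp
  have jbb := hself hf.smooth_b fun p hp => hf.inner_bb hp
  have jll := hself hf.smooth_l fun p hp => hf.inner_ll hp
  have jxy := fun p hp => hf.inner_fderiv_of_const (p := p) hf.smooth_x hf.smooth_y
    (fun p hp => hf.inner_xy hp) hp
  have jxb := fun p hp => hf.inner_fderiv_of_const (p := p) hf.smooth_x hf.smooth_b
    (fun p hp => hf.inner_xb hp) hp
  have jxl := fun p hp => hf.inner_fderiv_of_const (p := p) hf.smooth_x hf.smooth_l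
    (fun p hp => hf.inner_xl hp) hp
  have jyb := fun p hp => hf.inner_fderiv_of_const (p := p) hf.smooth_y hf.smooth_b
    (fun p hp => hf.inner_yb hp) hp
  have jyl := fun p hp => hf.inner_fderiv_of_const (p := p) hf.smooth_y hf.smooth_l
    (fun p hp => hf.inner_yl hp) hp
  have jbl := fun p hp => hf.inner_fderiv_of_const (p := p) hf.smooth_b hf.smooth_l
    (fun p hp => hf.inner_bl hp) hp
  have hsym : ∀ p ∈ D, pv x p = (pv (logAbs mu) p / 2) • x p - (pu (logAbs mu) p / 2) • y p +
      pu y p := fun p hp => by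
    have hd : DifferentiableAt ℝ (logAbs mu) p := hf.differentiableAt hp (contDiffOn_logAbs hmu hmu0)
    have e := hf.symmetry hp
    rw [← fderiv_u (conformalFactor mu), ← fderiv_v (conformalFactor mu),
      fderiv_conformalFactor hd, fderiv_conformalFactor hd, fderiv_u, fderiv_v] at e
    have e1 : conformalFactor mu p • pv x p = conformalFactor mu p •
        ((pv (logAbs mu) p / 2) • x p - (pu (logAbs mu) p / 2) • y p + pu y p) := by
      linear_combination (norm := module) e
    exact smul_right_injective E4 (hf.ne_zero hp) e1
  have hvx : ∀ p ∈ D, ∀ w, inner ℝ (pv x p) w = pv (logAbs mu) p / 2 * inner ℝ (x p) w -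
      pu (logAbs mu) p / 2 * inner ℝ (y p) w + inner ℝ (pu y p) w := fun p hp w => by
    rw [hsym p hp, inner_add_left, inner_sub_left, inner_smul_left, inner_smul_left]
    rfl
  -- Pair the symmetry relation with `x`: the left side vanishes because `x` has unit length.
  -- Pairing with `y` gives `k2` likewise.
  have k1 : ∀ p ∈ D, inner ℝ (pu y p) (x p) = -(pv (logAbs mu) p / 2) := fun p hp => by
    have e := hvx p hp (x p)
    rw [hf.inner_xx hp, real_inner_comm (x p) (y p), hf.inner_xy hp, ← fderiv_v, jxx p hp] at e
    linarith
  have k2 : ∀ p ∈ D, inner ℝ (pv x p) (y p) = -(pu (logAbs mu) p / 2) := fun p hp => by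
    have e := hvx p hp (y p)
    rw [hf.inner_xy hp, hf.inner_yy hp, ← fderiv_u y, jyy p hp] at e
    linarith
  have k3 : ∀ p ∈ D, inner ℝ (pv x p) (b p) = conformalFactor mu p * lam p := fun p hp => by
    rw [hvx p hp, hf.inner_xb hp, hf.inner_yb hp, i3 p hp]
    ring
  have k4 : ∀ p ∈ D, inner ℝ (pv x p) (l p) = conformalFactor mu p * mu p := fun p hp => by
    rw [hvx p hp, hf.inner_xl hp, hf.inner_yl hp, i4 p hp]
    ring
  have expand := fun p hp => eq_sum_of_orthonormal (hf.orthonormal p hp)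
  refine ⟨hf.smooth_z, hf.smooth_x, hf.smooth_y, hf.smooth_b, hf.smooth_l, hf.z_u, hf.z_v,
    fun p hp => ?_, fun p hp => ?_, fun p hp => ?_, fun p hp => ?_, fun p hp => ?_,
    fun p hp => ?_, fun p hp => ?_, fun p hp => ?_⟩
  · rw [expand p hp (pu x p), i1 p hp, i6 p hp, show inner ℝ (pu x p) (x p) = 0 from jxx p hp _,
      show inner ℝ (pu x p) (y p) = -inner ℝ (pu y p) (x p) from jxy p hp _, k1 p hp]
    module
  · rw [expand p hp (pv x p), show inner ℝ (pv x p) (x p) = 0 from jxx p hp _, k2 p hp, k3 p hp,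
      k4 p hp]
    module
  · rw [expand p hp (pu y p), show inner ℝ (pu y p) (y p) = 0 from jyy p hp _, k1 p hp, i3 p hp,
      i4 p hp]
    module
  · have e := jxy p hp (0, 1)
    rw [fderiv_v, fderiv_v, k2 p hp] at e
    rw [expand p hp (pv y p), i2 p hp, i7 p hp, show inner ℝ (pv y p) (y p) = 0 from jyy p hp _,
      show inner ℝ (pv y p) (x p) = pu (logAbs mu) p / 2 by linarith]
    module
  · have e1 := jxb p hp (1, 0)
    have e2 := jyb p hp (1, 0)
    rw [fderiv_u, fderiv_u, i1 p hp] at e1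
    rw [fderiv_u, fderiv_u, i3 p hp] at e2
    rw [expand p hp (pu b p), show inner ℝ (pu b p) (b p) = 0 from jbb p hp _,
      show inner ℝ (pu b p) (l p) = 0 from i8 p hp _, ← neg_eq_iff_eq_neg.mpr e1,
      ← neg_eq_iff_eq_neg.mpr e2]
    module
  · have e1 := jxb p hp (0, 1)
    have e2 := jyb p hp (0, 1)
    rw [fderiv_v, fderiv_v, k3 p hp] at e1
    rw [fderiv_v, fderiv_v, i2 p hp] at e2
    rw [expand p hp (pv b p), show inner ℝ (pv b p) (b p) = 0 from jbb p hp _,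
      show inner ℝ (pv b p) (l p) = 0 from i8 p hp _, ← neg_eq_iff_eq_neg.mpr e1,
      ← neg_eq_iff_eq_neg.mpr e2]
    module
  · have e1 := jxl p hp (1, 0)
    have e2 := jyl p hp (1, 0)
    have e3 := jbl p hp (1, 0)
    rw [fderiv_u, fderiv_u, i6 p hp] at e1
    rw [fderiv_u, fderiv_u, i4 p hp] at e2
    rw [i8 p hp, fderiv_u] at e3
    rw [expand p hp (pu l p), show inner ℝ (pu l p) (l p) = 0 from jll p hp _,
      ← neg_eq_iff_eq_neg.mpr e1, ← neg_eq_iff_eq_neg.mpr e2, ← neg_eq_iff_eq_neg.mpr e3]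
    module
  · have e1 := jxl p hp (0, 1)
    have e2 := jyl p hp (0, 1)
    have e3 := jbl p hp (0, 1)
    rw [fderiv_v, fderiv_v, k4 p hp] at e1
    rw [fderiv_v, fderiv_v, i7 p hp] at e2
    rw [i8 p hp, fderiv_v] at e3
    rw [expand p hp (pv l p), show inner ℝ (pv l p) (l p) = 0 from jll p hp _,
      ← neg_eq_iff_eq_neg.mpr e1, ← neg_eq_iff_eq_neg.mpr e2, ← neg_eq_iff_eq_neg.mpr e3]
    module

end Realization

end PNMC

end

/-! ### The fundamental theorem. -/

theorem mainTheorem1 (D : Set (ℝ × ℝ)) (hDopen : IsOpen D) (hDconn : IsConnected D)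
    (lam mu nu : ℝ × ℝ → ℝ)
    (hlam : ContDiffOn ℝ ∞ lam D) (hmu : ContDiffOn ℝ ∞ mu D) (hnu : ContDiffOn ℝ ∞ nu D)
    (hmu0 : ∀ p ∈ D, mu p ≠ 0)
    (hnuconst : ¬ ∃ c : ℝ, ∀ p ∈ D, nu p = c)
    (h1 : ∀ p ∈ D, PNMC.pu nu p =
      PNMC.pv lam p - lam p * PNMC.pv (fun q => Real.log |mu q|) p)
    (h2 : ∀ p ∈ D, PNMC.pv nu p =
      PNMC.pu lam p - lam p * PNMC.pu (fun q => Real.log |mu q|) p)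
    (h3 : ∀ p ∈ D, nu p ^ 2 - (lam p ^ 2 + mu p ^ 2) =
      1 / 2 * |mu p| * PNMC.laplace (fun q => Real.log |mu q|) p) :
    (∃ q ∈ D, nu q ≠ 0) ∧
    ∀ q₀ ∈ D, nu q₀ ≠ 0 →
      ∀ p₀ x₀ y₀ b₀ l₀ : E4, Orthonormal ℝ ![x₀, y₀, b₀, l₀] →
        ∃ D₀ : Set (ℝ × ℝ), D₀ ⊆ D ∧ IsOpen D₀ ∧ IsConnected D₀ ∧ q₀ ∈ D₀ ∧
          ∃ z : ℝ × ℝ → E4,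
            PNMC.IsRealization D₀ lam mu nu q₀ p₀ x₀ y₀ b₀ l₀ z ∧
            ∀ z' : ℝ × ℝ → E4,
              PNMC.IsRealization D₀ lam mu nu q₀ p₀ x₀ y₀ b₀ l₀ z' →
                ∀ p ∈ D₀, z' p = z p := by 
  constructor
  · by_contra! h
    exact hnuconst ⟨0, h⟩
  intro q₀ hq₀ hnuq p₀ x₀ y₀ b₀ l₀ ho
  -- Solving inside this open set keeps `H = νb` nonzero on the ball. Uniqueness needs it too, to
  -- exclude an `l` component of `σ(x,x)`.
  have hU : IsOpen (D ∩ {p | nu p ≠ 0}) :=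
    hnu.continuousOn.isOpen_inter_preimage hDopen isOpen_ne
  have hUD : D ∩ {p | nu p ≠ 0} ⊆ D := Set.inter_subset_left
  obtain ⟨ε, hε, hsub, z, x, y, b, l, hz, rfl, rfl, rfl, rfl, rfl⟩ :=
    PNMC.exists_canonicalEquations hU (hlam.mono hUD) (hmu.mono hUD) (hnu.mono hUD)
      (fun p hp => hmu0 p (hUD hp)) (fun p hp => h1 p (hUD hp)) (fun p hp => h2 p (hUD hp))
      (fun p hp => h3 p (hUD hp)) ⟨hq₀, hnuq⟩ p₀ x₀ y₀ b₀ l₀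
  have hBD := hsub.trans hUD
  have hB : IsOpen (Metric.ball q₀ ε) := Metric.isOpen_ball
  have hBc : IsConnected (Metric.ball q₀ ε) :=
    (convex_ball q₀ ε).isConnected ⟨q₀, Metric.mem_ball_self hε⟩
  have hqB : q₀ ∈ Metric.ball q₀ ε := Metric.mem_ball_self hε
  have hmuB := hmu.mono hBD
  have hnuB := hnu.mono hBD
  have hmu0B : ∀ p ∈ Metric.ball q₀ ε, mu p ≠ 0 := fun p hp => hmu0 p (hBD hp)
  have hnu0B : ∀ p ∈ Metric.ball q₀ ε, nu p ≠ 0 := fun p hp => (hsub hp).2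
  have hf := hz.isothermalFrame hB hmuB hmu0B (hz.orthonormal hB hBc.isPreconnected hqB ho)
  refine ⟨Metric.ball q₀ ε, hBD, hB, hBc, hqB, z,
    hz.isRealization hf hnuB hmu0B hnu0B q₀, fun z' hz' p hp => ?_⟩
  obtain ⟨ez, x', y', b', l', hz'', ex, ey, eb, el⟩ :=
    PNMC.exists_canonicalEquations_of_isRealization hB hmuB hnuB hmu0B hnu0B hz'
  exact hz''.eqOn hz hB hBc.isPreconnected hqB ez ex ey eb el p hp
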